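/- Let $\Gamma$ be a finite graph (loops and parallel edges allowed) with a chosen base vertex and a linear order on its edges. A reduced enhanced state $S$ of $\Gamma$ is a spanning subgraph (all vertices, some of the edges) whose connected components are colored by $1$ or $x$, the component of the base vertex being colored $x$. Its dimension is its number of edges, and its degree is the number of components colored $x$, minus $1$. Let $\widetilde C^{i,j}(\Gamma)$ be the real vector space with basis the reduced enhanced states of dimension $i$ and degree $j$. The differential $d:\widetilde C^{i,j}(\Gamma)\to\widetilde C^{i+1,j}(\Gamma)$ sends $S$ to $\sum_{e\notin S}(-1)^{\#\{f\in S\,:\,f<e\}}\,(S\cup e)$. Here, if $e$ joins two vertices of the same component of $S$, then $S\cup e$ keeps the coloring of $S$; if $e$ connects two different components, then the new component is colored by the product of their colors according to $1\cdot 1=1$, $1\cdot x=x\cdot 1=x$, $x\cdot x=0$ (the summand is $0$ if the product is $0$), and the other components keep their colors. The reduced chromatic cohomology of $\Gamma$ is $\widetilde H^{i,j}(\Gamma)=\ker(d:\widetilde C^{i,j}\to\widetilde C^{i+1,j})/\operatorname{im}(d:\widetilde C^{i-1,j}\to\widetilde C^{i,j})$. **Proposition.** Let $n\ge 1$ and let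 $C_n$ be the cycle with $n$ vertices (for $n=1$ a vertex with a loop, for $n=2$ two vertices joined by two parallel edges), with any base vertex and any order on its edges. Then for $0\le i\le n-2$ the group $\widetilde H^{i}(C_n)=\bigoplus_j\widetilde H^{i,j}(C_n)$ is $\mathbb R$ placed in degree $j=n-i-1$, that is, $\widetilde H^{i,n-i-1}(C_n)\cong\mathbb R$ and $\widetilde H^{i,j}(C_n)=0$ for $j\ne n-i-1$; for all other integers $i$, $\widetilde H^{i,j}(C_n)=0$ for every $j$. -/

import Mathlib

open scoped Graph

namespace ChromaticCohomology

variable {α β : Type*}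

/-! ### States of a multigraph and their connected components -/

/-- The equivalence relation on the vertices of `Γ` whose classes are the connected components
of the spanning subgraph of `Γ` with edge set `s`. -/
def connSetoid (Γ : Graph α β) (s : Finset β) : Setoid V(Γ) :=
  Relation.EqvGen.setoid fun u w : V(Γ) => (Γ.restrict (s : Set β)).Adj u w

/-- The connected components of the spanning subgraph of `Γ` with edge set `s`. -/
abbrev Component (Γ : Graph α β) (s : Finset β) : Type _ := Quotient (connSetoid Γ s)

/-- The two colors `1` and `x`. -/
inductive Color
  | one
  | x

/-- The multiplication `1 * 1 = 1`, `1 * x = x * 1 = x`, `x * x = 0`, where `none` stands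
for `0`. -/
def Color.mul : Color → Color → Option Color
  | .one, c => some c
  | .x, .one => some .x
  | .x, .x => none

theorem Color.mul_eq_some {a b c : Color} (h : Color.mul a b = some c) :
    c = Color.x ↔ a = Color.x ∨ b = Color.x := by
  revert h
  cases a <;> cases b <;> cases c <;> simp [Color.mul]

/-- A reduced enhanced state of `Γ` with base point `v₀`: a spanning subgraph (given by its finite
set of edges) with a coloring of its connected components by `1` and `x`, for which the component
of the base point has color `x`. -/
structure EnhancedState (Γ : Graph α β) (v₀ : V(Γ)) where
  edges : Finset β
  edges_subset : (edges : Set β) ⊆ E(Γ)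
  color : Component Γ edges → Color
  color_base : color (Quotient.mk _ v₀) = Color.x

variable {Γ : Graph α β} {v₀ : V(Γ)}

namespace EnhancedState

/-- The color of the component containing the vertex `w`. -/
def colorAt (S : EnhancedState Γ v₀) (w : V(Γ)) : Color := S.color (Quotient.mk _ w)

/-- The vertices `u` and `w` lie in the same connected component of the state. -/
def Conn (S : EnhancedState Γ v₀) (u w : V(Γ)) : Prop := connSetoid Γ S.edges u w

/-- The dimension of an enhanced state: its number of edges. -/
def dim (S : EnhancedState Γ v₀) : ℤ := S.edges.card

/-- The degree of an enhanced state: the number of components colored `x`, minus `1`. -/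
noncomputable def degree (S : EnhancedState Γ v₀) : ℤ :=
  (Nat.card {C : Component Γ S.edges // S.color C = Color.x} : ℤ) - 1

/-- An enhanced state from a coloring of the vertices that is constant along every edge of the
state. -/
def ofColoring (s : Finset β) (hs : (s : Set β) ⊆ E(Γ)) (f : V(Γ) → Color)
    (hf : ∀ e ∈ s, ∀ u w : V(Γ), Γ.IsLink e u w → f u = f w) (h₀ : f v₀ = Color.x) :
    EnhancedState Γ v₀ where
  edges := s
  edges_subset := hs
  color := Quotient.lift f (fun a b hab => by
    induction hab with
    | rel u w h =>
      obtain ⟨e, he, hl⟩ := h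
      exact hf e he u w hl
    | refl => rfl
    | symm _ _ _ ih => exact ih.symm
    | trans _ _ _ _ _ ih₁ ih₂ => exact ih₁.trans ih₂)
  color_base := h₀

theorem conn_of_isLink (S : EnhancedState Γ v₀) {e : β} (he : e ∈ S.edges) {u w : V(Γ)}
    (h : Γ.IsLink e u w) : S.Conn u w :=
  Relation.EqvGen.rel _ _ ⟨e, he, h⟩

theorem colorAt_eq_of_conn (S : EnhancedState Γ v₀) {u w : V(Γ)} (h : S.Conn u w) :
    S.colorAt u = S.colorAt w :=
  congrArg S.color (Quotient.sound h)

end EnhancedState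

/-- The two ends of an edge, in an arbitrary order. -/
theorem exists_ends (e : E(Γ)) : ∃ p : V(Γ) × V(Γ), Γ.IsLink e p.1 p.2 := by
  obtain ⟨u, w, h⟩ := Γ.exists_isLink_of_mem_edgeSet e.2
  exact ⟨(⟨u, h.left_mem⟩, ⟨w, h.right_mem⟩), h⟩

/-- The two ends of an edge, in an arbitrary order. -/
noncomputable def ends (e : E(Γ)) : V(Γ) × V(Γ) := (exists_ends e).choose

theorem isLink_ends (e : E(Γ)) : Γ.IsLink e (ends e).1 (ends e).2 := (exists_ends e).choose_spec

namespace EnhancedState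

open Classical in
/-- Adding an edge `e` to a reduced enhanced state `S`. If the ends of `e` lie in the same component
of `S`, then the coloring is preserved. If `e` connects two different components, then the
new component gets the product of their two colors, and all other components keep theirs; if this
product is `0`, then the result is `0`, which is written as `none`. -/
noncomputable def addEdge (S : EnhancedState Γ v₀) (e : E(Γ)) : Option (EnhancedState Γ v₀) :=
  if hab : S.Conn (ends e).1 (ends e).2 then
    some (ofColoring (insert e.1 S.edges)
      (by
        rw [Finset.coe_insert]
        exact Set.insert_subset e.2 S.edges_subset)
      S.colorAt
      (by
        intro f hf u w h
        rcases Finset.mem_insert.1 hf with rfl | hf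
        · rcases (isLink_ends e).eq_and_eq_or_eq_and_eq h with ⟨h₁, h₂⟩ | ⟨h₁, h₂⟩
          · rw [← Subtype.ext h₁, ← Subtype.ext h₂]
            exact S.colorAt_eq_of_conn hab
          · rw [← Subtype.ext h₁, ← Subtype.ext h₂]
            exact (S.colorAt_eq_of_conn hab).symm
        · exact S.colorAt_eq_of_conn (S.conn_of_isLink hf h))
      S.color_base)
  else
    match hc : Color.mul (S.colorAt (ends e).1) (S.colorAt (ends e).2) with
    | none => none
    | some c =>
      some (ofColoring (insert e.1 S.edges)
        (by
          rw [Finset.coe_insert]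
          exact Set.insert_subset e.2 S.edges_subset)
        (fun w => if S.Conn w (ends e).1 ∨ S.Conn w (ends e).2 then c else S.colorAt w)
        (by
          intro f hf u w h
          rcases Finset.mem_insert.1 hf with rfl | hf
          · have hr : ∀ z, S.Conn z z := fun z => Relation.EqvGen.refl z
            rcases (isLink_ends e).eq_and_eq_or_eq_and_eq h with ⟨h₁, h₂⟩ | ⟨h₁, h₂⟩
            · rw [← Subtype.ext h₁, ← Subtype.ext h₂, if_pos (Or.inl (hr _)),
                if_pos (Or.inr (hr _))]
            · rw [← Subtype.ext h₁, ← Subtype.ext h₂, if_pos (Or.inl (hr _)),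
                if_pos (Or.inr (hr _))]
          · have huw := S.conn_of_isLink hf h
            have ht : ∀ z, S.Conn u z ↔ S.Conn w z := fun z =>
              ⟨fun k => Relation.EqvGen.trans _ _ _ (Relation.EqvGen.symm _ _ huw) k,
                fun k => Relation.EqvGen.trans _ _ _ huw k⟩
            simp only [ht, S.colorAt_eq_of_conn huw])
        (by
          have hx : S.colorAt v₀ = Color.x := S.color_base
          split_ifs with h
          · rcases h with h | h
            · rw [← S.colorAt_eq_of_conn h, hx] at hc
              exact (Color.mul_eq_some hc).2 (Or.inl rfl)
            · rw [← S.colorAt_eq_of_conn h, hx] at hc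
              exact (Color.mul_eq_some hc).2 (Or.inr rfl)
          · exact hx))

/-- The sign with which the edge `e` is added to `S`: it is `-1` to the number of edges of `S` that
come before `e`. -/
def sign [LinearOrder β] (S : EnhancedState Γ v₀) (e : β) : ℝ :=
  (-1) ^ (S.edges.filter (· < e)).card

end EnhancedState

/-! ### The bigraded complex and its cohomology -/

/-- The real vector space with basis the set of all reduced enhanced states. -/
def Chain (Γ : Graph α β) (v₀ : V(Γ)) : Type _ := EnhancedState Γ v₀ →₀ ℝ

noncomputable instance (Γ : Graph α β) (v₀ : V(Γ)) : AddCommGroup (Chain Γ v₀) :=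
  inferInstanceAs (AddCommGroup (EnhancedState Γ v₀ →₀ ℝ))

noncomputable instance (Γ : Graph α β) (v₀ : V(Γ)) : Module ℝ (Chain Γ v₀) :=
  inferInstanceAs (Module ℝ (EnhancedState Γ v₀ →₀ ℝ))

/-- The basis of the chain space that consists of the reduced enhanced states. -/
noncomputable def stateBasis (Γ : Graph α β) (v₀ : V(Γ)) :
    Module.Basis (EnhancedState Γ v₀) ℝ (Chain Γ v₀) :=
  Module.Basis.ofRepr (LinearEquiv.refl ℝ (EnhancedState Γ v₀ →₀ ℝ))

/-- The cochain group of bidegree `(i, j)`, spanned by the reduced enhanced states of dimension `i`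
and degree `j`. -/
noncomputable def cochains (Γ : Graph α β) (v₀ : V(Γ)) (i j : ℤ) : Submodule ℝ (Chain Γ v₀) :=
  Submodule.span ℝ {c | ∃ S : EnhancedState Γ v₀, S.dim = i ∧ S.degree = j ∧
    stateBasis Γ v₀ S = c}

/-- An enhanced state, or `0`, as a vector. -/
noncomputable def vec : Option (EnhancedState Γ v₀) → Chain Γ v₀
  | none => 0
  | some T => stateBasis Γ v₀ T

open Classical in
/-- The differential: it adds to a state, in all possible ways, an edge that the state does not
have, with signs. -/
noncomputable def diff [LinearOrder β] (Γ : Graph α β) [Finite E(Γ)] (v₀ : V(Γ)) :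
    Chain Γ v₀ →ₗ[ℝ] Chain Γ v₀ :=
  letI := Fintype.ofFinite E(Γ)
  (stateBasis Γ v₀).constr ℝ fun S : EnhancedState Γ v₀ =>
    ∑ e : E(Γ) with e.1 ∉ S.edges, S.sign e.1 • vec (S.addEdge e)

/-- The cocycles of bidegree `(i, j)`: the kernel of the differential on the cochains of bidegree
`(i, j)`. -/
noncomputable def cocycles [LinearOrder β] (Γ : Graph α β) [Finite E(Γ)] (v₀ : V(Γ)) (i j : ℤ) :
    Submodule ℝ (Chain Γ v₀) :=
  cochains Γ v₀ i j ⊓ LinearMap.ker (diff Γ v₀)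

/-- The coboundaries of bidegree `(i, j)`: the image under the differential of the cochains of
bidegree `(i - 1, j)`. -/
noncomputable def coboundaries [LinearOrder β] (Γ : Graph α β) [Finite E(Γ)] (v₀ : V(Γ))
    (i j : ℤ) : Submodule ℝ (Chain Γ v₀) :=
  (cochains Γ v₀ (i - 1) j).map (diff Γ v₀)

/-- The reduced chromatic cohomology of `Γ` with base point `v₀` in bidegree `(i, j)`: cocycles
modulo coboundaries. -/
abbrev ReducedCohomology [LinearOrder β] (Γ : Graph α β) [Finite E(Γ)] (v₀ : V(Γ)) (i j : ℤ) :
    Type _ :=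
  cocycles Γ v₀ i j ⧸ (coboundaries Γ v₀ i j).submoduleOf (cocycles Γ v₀ i j)

theorem connSetoid_mono {s t : Finset β} (h : s ⊆ t) {u w : V(Γ)} (huw : connSetoid Γ s u w) :
    connSetoid Γ t u w := by
  induction huw with
  | rel u w k =>
    obtain ⟨e, he, hl⟩ := k
    exact Relation.EqvGen.rel _ _ ⟨e, h he, hl⟩
  | refl z => exact Relation.EqvGen.refl z
  | symm _ _ _ ih => exact Relation.EqvGen.symm _ _ ih
  | trans _ _ _ _ _ ih₁ ih₂ => exact Relation.EqvGen.trans _ _ _ ih₁ ih₂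

theorem connSetoid_insert [DecidableEq β] {s : Finset β} {e : β} {a b : V(Γ)} (he : Γ.IsLink e a b)
    {u w : V(Γ)} (h : connSetoid Γ (insert e s) u w) :
    connSetoid Γ s u w ∨ (connSetoid Γ s u a ∧ connSetoid Γ s w b) ∨
      (connSetoid Γ s u b ∧ connSetoid Γ s w a) := by
  have rf : ∀ z, connSetoid Γ s z z := (connSetoid Γ s).refl
  have sy : ∀ {y z}, connSetoid Γ s y z → connSetoid Γ s z y := (connSetoid Γ s).symm
  have tr : ∀ {x y z}, connSetoid Γ s x y → connSetoid Γ s y z → connSetoid Γ s x z :=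
    (connSetoid Γ s).trans
  induction h with
  | rel u w h =>
    obtain ⟨f, hf, hl⟩ := h
    rcases Finset.mem_insert.1 hf with rfl | hf
    · rcases he.eq_and_eq_or_eq_and_eq hl with ⟨h₁, h₂⟩ | ⟨h₁, h₂⟩
      · obtain rfl := Subtype.ext h₁
        obtain rfl := Subtype.ext h₂
        exact Or.inr (Or.inl ⟨rf _, rf _⟩)
      · obtain rfl := Subtype.ext h₁
        obtain rfl := Subtype.ext h₂
        exact Or.inr (Or.inr ⟨rf _, rf _⟩)
    · exact Or.inl (Relation.EqvGen.rel _ _ ⟨f, hf, hl⟩)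
  | refl z => exact Or.inl (rf z)
  | symm _ _ _ ih =>
    rcases ih with h | ⟨h₁, h₂⟩ | ⟨h₁, h₂⟩
    · exact Or.inl (sy h)
    · exact Or.inr (Or.inr ⟨h₂, h₁⟩)
    · exact Or.inr (Or.inl ⟨h₂, h₁⟩)
  | trans _ _ _ _ _ ih₁ ih₂ =>
    rcases ih₁ with h | ⟨h₁, h₂⟩ | ⟨h₁, h₂⟩ <;> rcases ih₂ with k | ⟨k₁, k₂⟩ | ⟨k₁, k₂⟩
    · exact Or.inl (tr h k)
    · exact Or.inr (Or.inl ⟨tr h k₁, k₂⟩)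
    · exact Or.inr (Or.inr ⟨tr h k₁, k₂⟩)
    · exact Or.inr (Or.inl ⟨h₁, tr (sy k) h₂⟩)
    · exact Or.inl (tr h₁ (tr (sy k₁) (tr h₂ (sy k₂))))
    · exact Or.inl (tr h₁ (sy k₂))
    · exact Or.inr (Or.inr ⟨h₁, tr (sy k) h₂⟩)
    · exact Or.inl (tr h₁ (sy k₂))
    · exact Or.inl (tr h₁ (tr (sy k₁) (tr h₂ (sy k₂))))

namespace EnhancedState

theorem ext_of_colorAt {S T : EnhancedState Γ v₀} (h : S.edges = T.edges)
    (hc : ∀ w, S.colorAt w = T.colorAt w) : S = T := by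
  obtain ⟨s, hs, c, h₀⟩ := S
  obtain ⟨t, ht, c', h₀'⟩ := T
  obtain rfl : s = t := h
  congr
  funext C
  induction C using Quotient.inductionOn with
  | h w => exact hc w

/-- `T` arises from `S` by adding edges: every component of `T` contains at most one component of
`S` with color `x`, and it has color `x` itself if and only if it contains one. -/
structure Extends (S T : EnhancedState Γ v₀) : Prop where
  subset : S.edges ⊆ T.edges
  inj : ∀ u w, S.colorAt u = Color.x → S.colorAt w = Color.x → T.Conn u w → S.Conn u w
  color : ∀ w, T.colorAt w = Color.x ↔ ∃ u, T.Conn u w ∧ S.colorAt u = Color.x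

theorem addEdge_some {S T : EnhancedState Γ v₀} {e : E(Γ)} (h : S.addEdge e = some T) :
    (∀ f, f ∈ T.edges ↔ f = e.1 ∨ f ∈ S.edges) ∧ S.Extends T := by
  classical
  have sy : ∀ {y z}, S.Conn y z → S.Conn z y := (connSetoid Γ S.edges).symm
  have tr : ∀ {x y z}, S.Conn x y → S.Conn y z → S.Conn x z := (connSetoid Γ S.edges).trans
  have rf : ∀ z, S.Conn z z := (connSetoid Γ S.edges).refl
  unfold addEdge at h
  split_ifs at h with hab
  · obtain rfl := Option.some.inj h
    have hT : ∀ u w, connSetoid Γ (insert e.1 S.edges) u w → S.Conn u w := by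
      intro u w huw
      rcases connSetoid_insert (isLink_ends e) huw with k | ⟨k₁, k₂⟩ | ⟨k₁, k₂⟩
      · exact k
      · exact tr k₁ (tr hab (sy k₂))
      · exact tr k₁ (tr (sy hab) (sy k₂))
    refine ⟨fun f => ?_, ⟨?_, fun u w _ _ k => hT u w ?_, fun w => ?_⟩⟩
    · simp [ofColoring]
    · exact Finset.subset_insert _ _
    · exact k
    · change S.colorAt w = Color.x ↔ _
      refine ⟨fun k => ⟨w, Relation.EqvGen.refl w, k⟩, fun ⟨u, k, k'⟩ => ?_⟩
      rw [← S.colorAt_eq_of_conn (hT u w k), k']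
  · split at h
    · simp at h
    · rename_i c hc
      have hTd := Option.some.inj h
      have hT : ∀ u w, connSetoid Γ (insert e.1 S.edges) u w → _ :=
        fun u w huw => connSetoid_insert (isLink_ends e) huw
      have hcx := Color.mul_eq_some hc
      have hxx : ¬ (S.colorAt (ends e).1 = Color.x ∧ S.colorAt (ends e).2 = Color.x) := by
        rintro ⟨h₁, h₂⟩
        rw [h₁, h₂] at hc
        simp [Color.mul] at hc
      subst hTd
      refine ⟨fun f => ?_, ⟨?_, fun u w hu hw k => ?_, fun w => ?_⟩⟩
      · simp [ofColoring]
      · exact Finset.subset_insert _ _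
      · rcases hT u w k with k | ⟨k₁, k₂⟩ | ⟨k₁, k₂⟩
        · exact k
        · rw [S.colorAt_eq_of_conn k₁] at hu
          rw [S.colorAt_eq_of_conn k₂] at hw
          exact absurd ⟨hu, hw⟩ hxx
        · rw [S.colorAt_eq_of_conn k₁] at hu
          rw [S.colorAt_eq_of_conn k₂] at hw
          exact absurd ⟨hw, hu⟩ hxx
      · change (if S.Conn w (ends e).1 ∨ S.Conn w (ends e).2 then c else S.colorAt w) = Color.x ↔
          ∃ u, connSetoid Γ (insert e.1 S.edges) u w ∧ _
        have hmono : ∀ {y z}, S.Conn y z → connSetoid Γ (insert e.1 S.edges) y z :=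
          fun k => connSetoid_mono (Finset.subset_insert _ _) k
        have hE : connSetoid Γ (insert e.1 S.edges) (ends e).1 (ends e).2 :=
          Relation.EqvGen.rel _ _ ⟨e.1, by simp, isLink_ends e⟩
        have syT : ∀ {y z}, connSetoid Γ (insert e.1 S.edges) y z →
            connSetoid Γ (insert e.1 S.edges) z y :=
          (connSetoid Γ (insert e.1 S.edges)).symm
        have trT : ∀ {x y z}, connSetoid Γ (insert e.1 S.edges) x y →
            connSetoid Γ (insert e.1 S.edges) y z → connSetoid Γ (insert e.1 S.edges) x z :=
          (connSetoid Γ (insert e.1 S.edges)).trans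
        split_ifs with hw
        · rw [hcx]
          constructor
          · rintro (k | k)
            · refine ⟨_, ?_, k⟩
              rcases hw with hw | hw
              · exact syT (hmono hw)
              · exact trT hE (syT (hmono hw))
            · refine ⟨_, ?_, k⟩
              rcases hw with hw | hw
              · exact trT (syT hE) (syT (hmono hw))
              · exact syT (hmono hw)
          · rintro ⟨u, k, k'⟩
            rcases hT u w k with k | ⟨k₁, k₂⟩ | ⟨k₁, k₂⟩
            · rcases hw with hw | hw
              · exact Or.inl ((S.colorAt_eq_of_conn (tr k hw)).symm.trans k')
              · exact Or.inr ((S.colorAt_eq_of_conn (tr k hw)).symm.trans k')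
            · exact Or.inl ((S.colorAt_eq_of_conn k₁).symm.trans k')
            · exact Or.inr ((S.colorAt_eq_of_conn k₁).symm.trans k')
        · refine ⟨fun k => ⟨w, Relation.EqvGen.refl w, k⟩, fun ⟨u, k, k'⟩ => ?_⟩
          rcases hT u w k with k | ⟨k₁, k₂⟩ | ⟨k₁, k₂⟩
          · exact (S.colorAt_eq_of_conn k).symm.trans k'
          · exact absurd (Or.inr k₂) hw
          · exact absurd (Or.inl k₂) hw

theorem addEdge_none {S : EnhancedState Γ v₀} {e : E(Γ)} (h : S.addEdge e = none) :
    ∃ u w, S.colorAt u = Color.x ∧ S.colorAt w = Color.x ∧ ¬ S.Conn u w ∧ Γ.IsLink e u w := by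
  unfold addEdge at h
  split_ifs at h with hab
  split at h
  · rename_i hc
    refine ⟨(ends e).1, (ends e).2, ?_, ?_, hab, isLink_ends e⟩ <;>
    · revert hc
      cases S.colorAt (ends e).1 <;> cases S.colorAt (ends e).2 <;> simp [Color.mul]
  · simp at h

theorem Extends.degree_eq {S T : EnhancedState Γ v₀} (h : S.Extends T) : T.degree = S.degree := by
  unfold degree
  congr 2
  symm
  have hm : ∀ {u w}, S.Conn u w → T.Conn u w := fun k => connSetoid_mono h.subset k
  refine Nat.card_eq_of_bijective (f := fun C : {C // S.color C = Color.x} =>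
    (⟨Quotient.map' (s₁ := connSetoid Γ S.edges) (s₂ := connSetoid Γ T.edges) id
      (fun _ _ k => hm k) C.1, ?_⟩ : {C // T.color C = Color.x})) ⟨?_, ?_⟩
  · obtain ⟨C, hC⟩ := C
    induction C using Quotient.inductionOn with
    | h w => exact (h.color w).2 ⟨w, Relation.EqvGen.refl w, hC⟩
  · rintro ⟨C, hC⟩ ⟨D, hD⟩ hCD
    induction C using Quotient.inductionOn with
    | h u =>
      induction D using Quotient.inductionOn with
      | h w =>
        have := Subtype.ext_iff.1 hCD
        exact Subtype.ext (Quotient.sound (h.inj u w hC hD (Quotient.exact this)))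
  · rintro ⟨C, hC⟩
    induction C using Quotient.inductionOn with
    | h w =>
      obtain ⟨u, k, k'⟩ := (h.color w).1 hC
      exact ⟨⟨Quotient.mk _ u, k'⟩, Subtype.ext (Quotient.sound k)⟩

theorem Extends.trans {S T U : EnhancedState Γ v₀} (h : S.Extends T) (k : T.Extends U) :
    S.Extends U where
  subset := h.subset.trans k.subset
  inj u w hu hw huw := by
    refine h.inj u w hu hw (k.inj u w ?_ ?_ huw)
    · exact (h.color u).2 ⟨u, Relation.EqvGen.refl u, hu⟩
    · exact (h.color w).2 ⟨w, Relation.EqvGen.refl w, hw⟩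
  color w := by
    rw [k.color]
    constructor
    · rintro ⟨u, hu, hx⟩
      obtain ⟨z, hz, hx⟩ := (h.color u).1 hx
      exact ⟨z, (connSetoid Γ U.edges).trans (connSetoid_mono k.subset hz) hu, hx⟩
    · rintro ⟨u, hu, hx⟩
      exact ⟨u, hu, (h.color u).2 ⟨u, Relation.EqvGen.refl u, hx⟩⟩

theorem Extends.unique {S T U : EnhancedState Γ v₀} (h : S.Extends T) (k : S.Extends U)
    (he : T.edges = U.edges) : T = U := by
  refine ext_of_colorAt he fun w => ?_
  have hx : T.colorAt w = Color.x ↔ U.colorAt w = Color.x := by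
    rw [h.color, k.color]
    unfold Conn
    rw [he]
  revert hx
  cases T.colorAt w <;> cases U.colorAt w <;> simp

/-- Adding two edges, one after the other. -/
theorem addEdge_bind_some {S U : EnhancedState Γ v₀} {e f : E(Γ)}
    (h : (S.addEdge e).bind (fun T => T.addEdge f) = some U) :
    (∀ g, g ∈ U.edges ↔ g = f.1 ∨ g = e.1 ∨ g ∈ S.edges) ∧ S.Extends U := by
  obtain ⟨T, hT, hU⟩ := Option.bind_eq_some_iff.1 h
  obtain ⟨h₁, h₂⟩ := addEdge_some hT
  obtain ⟨k₁, k₂⟩ := addEdge_some hU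
  exact ⟨fun g => by rw [k₁, h₁], h₂.trans k₂⟩

theorem addEdge_bind_none {S U : EnhancedState Γ v₀} {e f : E(Γ)}
    (h : (S.addEdge e).bind (fun T => T.addEdge f) = none)
    (he : e.1 ∈ U.edges) (hf : f.1 ∈ U.edges) : ¬ S.Extends U := by
  intro hU
  cases hT : S.addEdge e with
  | none =>
    obtain ⟨u, w, hu, hw, hn, hl⟩ := addEdge_none hT
    exact hn (hU.inj u w hu hw (U.conn_of_isLink he hl))
  | some T =>
    rw [hT] at h
    obtain ⟨h₁, h₂⟩ := addEdge_some hT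
    have hTU : T.edges ⊆ U.edges := by
      intro g hg
      rcases (h₁ g).1 hg with rfl | hg
      · exact he
      · exact hU.subset hg
    obtain ⟨u, w, hu, hw, hn, hl⟩ := addEdge_none h
    obtain ⟨u', ku, hu'⟩ := (h₂.color u).1 hu
    obtain ⟨w', kw, hw'⟩ := (h₂.color w).1 hw
    have sy := fun {y z} => (connSetoid Γ U.edges).symm (a := y) (b := z)
    have tr := fun {x y z} => (connSetoid Γ U.edges).trans (a := x) (b := y) (c := z)
    have hc : U.Conn u' w' := tr (connSetoid_mono hTU ku)
      (tr (U.conn_of_isLink hf hl) (sy (connSetoid_mono hTU kw)))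
    have hS : S.Conn u' w' := hU.inj u' w' hu' hw' hc
    refine hn ?_
    exact (connSetoid Γ T.edges).trans ((connSetoid Γ T.edges).symm ku)
      ((connSetoid Γ T.edges).trans (connSetoid_mono h₂.subset hS) kw)

theorem addEdge_comm (S : EnhancedState Γ v₀) (e f : E(Γ)) :
    (S.addEdge e).bind (fun T => T.addEdge f) = (S.addEdge f).bind (fun T => T.addEdge e) := by
  cases h : (S.addEdge e).bind (fun T => T.addEdge f) with
  | none =>
    cases k : (S.addEdge f).bind (fun T => T.addEdge e) with
    | none => rfl
    | some U =>
      obtain ⟨k₁, k₂⟩ := addEdge_bind_some k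
      exact absurd k₂ (addEdge_bind_none h (by simp [k₁]) (by simp [k₁]))
  | some U =>
    obtain ⟨h₁, h₂⟩ := addEdge_bind_some h
    cases k : (S.addEdge f).bind (fun T => T.addEdge e) with
    | none => exact absurd h₂ (addEdge_bind_none k (by simp [h₁]) (by simp [h₁]))
    | some U' =>
      obtain ⟨k₁, k₂⟩ := addEdge_bind_some k
      rw [h₂.unique k₂]
      ext g
      rw [h₁, k₁]
      tauto

end EnhancedState

theorem vec_mem_cochains {o : Option (EnhancedState Γ v₀)} {i j : ℤ}
    (h : ∀ T, o = some T → T.dim = i ∧ T.degree = j) : vec o ∈ cochains Γ v₀ i j := by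
  cases o with
  | none => exact Submodule.zero_mem _
  | some T => exact Submodule.subset_span ⟨T, (h T rfl).1, (h T rfl).2, rfl⟩

open Classical in
theorem diff_stateBasis [LinearOrder β] [Finite E(Γ)] [Fintype E(Γ)] (S : EnhancedState Γ v₀) :
    diff Γ v₀ (stateBasis Γ v₀ S) =
      ∑ e : E(Γ) with e.1 ∉ S.edges, S.sign e.1 • vec (S.addEdge e) := by
  unfold diff
  rw [Module.Basis.constr_basis]
  congr!

/-- The differential maps the cochains of bidegree `(i, j)` to those of bidegree `(i + 1, j)`. -/
theorem diff_mem_cochains [LinearOrder β] [Finite E(Γ)] {i j : ℤ} {c : Chain Γ v₀}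
    (hc : c ∈ cochains Γ v₀ i j) : diff Γ v₀ c ∈ cochains Γ v₀ (i + 1) j := by
  classical
  let _ := Fintype.ofFinite E(Γ)
  revert c
  change cochains Γ v₀ i j ≤ (cochains Γ v₀ (i + 1) j).comap (diff Γ v₀)
  refine Submodule.span_le.2 ?_
  rintro _ ⟨S, rfl, rfl, rfl⟩
  change diff Γ v₀ (stateBasis Γ v₀ S) ∈ cochains Γ v₀ (S.dim + 1) S.degree
  rw [diff_stateBasis]
  refine Submodule.sum_mem _ fun e he => Submodule.smul_mem _ _ (vec_mem_cochains fun T hT => ?_)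
  obtain ⟨h₁, h₂⟩ := EnhancedState.addEdge_some hT
  have hTe : T.edges = insert e.1 S.edges := by
    ext g
    simp [h₁]
  refine ⟨?_, h₂.degree_eq⟩
  unfold EnhancedState.dim
  rw [hTe, Finset.card_insert_of_notMem (Finset.mem_filter.1 he).2]
  push_cast
  ring

open Classical in
theorem diff_vec_addEdge [LinearOrder β] [Finite E(Γ)] [Fintype E(Γ)] (S : EnhancedState Γ v₀)
    (e : E(Γ)) (he : e.1 ∉ S.edges) : S.sign e.1 • diff Γ v₀ (vec (S.addEdge e)) =
      ∑ f : E(Γ) with f.1 ∉ S.edges ∧ f ≠ e,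
        (S.sign e.1 * S.sign f.1 * (if e.1 < f.1 then -1 else 1)) •
          vec ((S.addEdge e).bind fun T => T.addEdge f) := by
  cases hT : S.addEdge e with
  | none => simp [vec]
  | some T =>
    obtain ⟨h₁, -⟩ := EnhancedState.addEdge_some hT
    have hTe : T.edges = insert e.1 S.edges := by
      ext g
      simp [h₁]
    change S.sign e.1 • diff Γ v₀ (stateBasis Γ v₀ T) = _
    rw [diff_stateBasis, Finset.smul_sum]
    refine Finset.sum_congr ?_ fun f _ => ?_
    · ext f
      simp only [Finset.mem_filter, Finset.mem_univ, true_and, h₁, not_or, ne_eq, Subtype.ext_iff]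
      tauto
    · rw [smul_smul]
      congr 1
      rw [mul_assoc]
      congr 1
      unfold EnhancedState.sign
      rw [hTe, Finset.filter_insert]
      split_ifs with hlt
      · rw [Finset.card_insert_of_notMem (by simp [he]), pow_succ]
      · rw [mul_one]

/-- The square of the differential is zero. -/
theorem diff_diff [LinearOrder β] [Finite E(Γ)] (c : Chain Γ v₀) :
    diff Γ v₀ (diff Γ v₀ c) = 0 := by
  classical
  let _ := Fintype.ofFinite E(Γ)
  suffices h : diff Γ v₀ ∘ₗ diff Γ v₀ = 0 from LinearMap.congr_fun h c
  refine (stateBasis Γ v₀).ext fun S => ?_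
  rw [LinearMap.comp_apply, diff_stateBasis, map_sum, LinearMap.zero_apply]
  rw [Finset.sum_congr rfl (fun e he => by
    rw [map_smul, diff_vec_addEdge S e (Finset.mem_filter.1 he).2])]
  rw [Finset.sum_sigma']
  refine Finset.sum_involution (fun p _ => ⟨p.2, p.1⟩) ?_ ?_ ?_ ?_
  · rintro ⟨e, f⟩ hp
    simp only [Finset.mem_sigma, Finset.mem_filter, Finset.mem_univ, true_and] at hp
    dsimp only
    rw [S.addEdge_comm f e, ← add_smul]
    have hne : e.1 ≠ f.1 := fun h => hp.2.2 (Subtype.ext h.symm)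
    rcases lt_or_gt_of_ne hne with h | h
    · rw [if_pos h, if_neg h.asymm]
      convert zero_smul ℝ _ using 2
      ring
    · rw [if_pos h, if_neg h.asymm]
      convert zero_smul ℝ _ using 2
      ring
  · rintro ⟨e, f⟩ hp _ h
    simp only [Finset.mem_sigma, Finset.mem_filter, Finset.mem_univ, true_and] at hp
    exact hp.2.2 (congrArg Sigma.fst h)
  · rintro ⟨e, f⟩ hp
    simp only [Finset.mem_sigma, Finset.mem_filter, Finset.mem_univ, true_and] at hp ⊢
    exact ⟨hp.2.1, hp.1, fun h => hp.2.2 h.symm⟩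
  · rintro ⟨e, f⟩ _
    rfl

theorem coboundaries_le_cocycles [LinearOrder β] [Finite E(Γ)] (i j : ℤ) :
    coboundaries Γ v₀ i j ≤ cocycles Γ v₀ i j := by
  rintro _ ⟨c, hc, rfl⟩
  refine ⟨?_, diff_diff c⟩
  have := diff_mem_cochains hc
  rwa [sub_add_cancel] at this

/-! ### Cycles -/

/-- `Γ` is a cycle with `n` vertices: its vertices and its edges can be numbered bijectively
by `ℤ/n` so that the `k`-th edge joins the `k`-th and the `(k+1)`-st vertex. For `n = 1` this is a
vertex with a loop, for `n = 2` it is a pair of vertices joined by two parallel edges. -/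
def IsCycleGraph (Γ : Graph α β) (n : ℕ) : Prop :=
  ∃ (a : ZMod n ≃ V(Γ)) (b : ZMod n ≃ E(Γ)), ∀ k : ZMod n, Γ.IsLink (b k) (a k) (a (k + 1))

end ChromaticCohomology

namespace ChromaticCohomology

variable {α β : Type*} {Γ : Graph α β} {v₀ : V(Γ)}

/-! ### Matchings on the enhanced states -/

/-! The proof is discrete Morse theory on the enhanced states. Number the vertices cyclically from
the base vertex, so that the `l`-th edge joins the `l`-th and the `(l+1)`-st vertex. For a state let
`m` be the largest index `≥ 1` of a missing edge, or `0` if there is none. All vertices after the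
`m`-th one then belong to the base component. Going down from `m`, pass over isolated vertices of
color `x`, and stop at the first `k ≥ 1` that is not of this kind. Either the edge `k - 1` is
present, or the `k`-th vertex is isolated with color `1`; adding the edge `k - 1` matches the states
of the second kind with those of the first, because a factor `1` changes no other color. If `m = 0`,
the state is connected with or without the edge `0`, and this edge is the one that is added or
removed.

The search does not stop exactly when `m ≥ 1`, the edges `0, …, m` are missing and the vertices `1,
…, m` have color `x`. There is one such critical state for each `m` with `1 ≤ m ≤ n - 1`; its
dimension is `n - 1 - m` and its degree is `m`. Hence no bidegree has two critical states, and none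
lie in adjacent dimensions with equal degree, so each contributes one copy of `ℝ` and nothing else
survives.

The algebra is in `Matching.cochains_le` and `Matching.eq_zero_of_diff_mem`: with respect to the
rank, the differential from lower to upper states is triangular with entries `±1` on the diagonal.
Acyclicity for the cycle is `IsLower.lt_of_isUpper`, and bijectivity of the matching is
`IsUpper.exists_isLower` with `IsLower.eq_of_addEdge`. -/

/-- The span of the enhanced states that satisfy `P`. -/
noncomputable def stateSpan (P : EnhancedState Γ v₀ → Prop) : Submodule ℝ (Chain Γ v₀) :=
  Submodule.span ℝ (stateBasis Γ v₀ '' {S | P S})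

theorem mem_stateSpan_iff {P : EnhancedState Γ v₀ → Prop} {c : Chain Γ v₀} :
    c ∈ stateSpan P ↔ ∀ S, (stateBasis Γ v₀).repr c S ≠ 0 → P S := by
  unfold stateSpan
  rw [Module.Basis.mem_span_image]
  constructor
  · intro h S hS
    exact h (Finsupp.mem_support_iff.2 hS)
  · intro h S hS
    exact h S (Finsupp.mem_support_iff.1 hS)

theorem stateBasis_mem_stateSpan {P : EnhancedState Γ v₀ → Prop} {S : EnhancedState Γ v₀}
    (h : P S) : stateBasis Γ v₀ S ∈ stateSpan P :=
  Submodule.subset_span ⟨S, h, rfl⟩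

theorem stateSpan_mono {P Q : EnhancedState Γ v₀ → Prop} (h : ∀ S, P S → Q S) :
    stateSpan P ≤ stateSpan Q :=
  Submodule.span_mono (Set.image_mono h)

theorem cochains_eq_stateSpan (i j : ℤ) :
    cochains Γ v₀ i j = stateSpan fun S => S.dim = i ∧ S.degree = j := by
  unfold cochains stateSpan
  congr 1
  ext c
  simp [and_assoc]

theorem stateSpan_le_cochains {P : EnhancedState Γ v₀ → Prop} {i j : ℤ} :
    stateSpan (fun S => (S.dim = i ∧ S.degree = j) ∧ P S) ≤ cochains Γ v₀ i j := by
  rw [cochains_eq_stateSpan]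
  exact stateSpan_mono fun S h => h.1

theorem EnhancedState.addEdge_bidegree {S T : EnhancedState Γ v₀} {e : E(Γ)} (he : e.1 ∉ S.edges)
    (h : S.addEdge e = some T) : T.dim = S.dim + 1 ∧ T.degree = S.degree := by
  classical
  obtain ⟨h₁, h₂⟩ := EnhancedState.addEdge_some h
  have hTe : T.edges = insert e.1 S.edges := by
    ext g
    simp [h₁]
  refine ⟨?_, h₂.degree_eq⟩
  unfold EnhancedState.dim
  rw [hTe, Finset.card_insert_of_notMem he]
  push_cast
  ring

section Matching

variable [LinearOrder β]

theorem EnhancedState.sign_ne_zero (S : EnhancedState Γ v₀) (e : β) : S.sign e ≠ 0 := by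
  unfold EnhancedState.sign
  exact pow_ne_zero _ (by norm_num)

variable [Finite E(Γ)]

/-- The coefficient of `T` in the differential of a state that becomes `T` by adding no edge. -/
theorem repr_diff_eq_zero {S T : EnhancedState Γ v₀}
    (h : ∀ f : E(Γ), f.1 ∉ S.edges → S.addEdge f ≠ some T) :
    (stateBasis Γ v₀).repr (diff Γ v₀ (stateBasis Γ v₀ S)) T = 0 := by
  classical
  let _ := Fintype.ofFinite E(Γ)
  rw [diff_stateBasis, map_sum, Finsupp.finsetSum_apply]
  refine Finset.sum_eq_zero fun f hf => ?_
  have hf := h f (Finset.mem_filter.1 hf).2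
  cases hU : S.addEdge f with
  | none => simp [vec]
  | some U =>
    have : U ≠ T := by
      rintro rfl
      exact hf hU
    simp [vec, this]

/-- The coefficient of `T` in the differential of a state that becomes `T` by adding exactly
one edge. -/
theorem repr_diff_eq_sign {S T : EnhancedState Γ v₀} {e : E(Γ)} (he : e.1 ∉ S.edges)
    (hT : S.addEdge e = some T) (h : ∀ f : E(Γ), f.1 ∉ S.edges → S.addEdge f = some T → f = e) :
    (stateBasis Γ v₀).repr (diff Γ v₀ (stateBasis Γ v₀ S)) T = S.sign e.1 := by
  classical
  let _ := Fintype.ofFinite E(Γ)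
  rw [diff_stateBasis, map_sum, Finsupp.finsetSum_apply, Finset.sum_eq_single e]
  · simp [hT, vec]
  · intro f hf hfe
    have hf := fun k => hfe (h f (Finset.mem_filter.1 hf).2 k)
    cases hU : S.addEdge f with
    | none => simp [vec]
    | some U =>
      have : U ≠ T := by
        rintro rfl
        exact hf hU
      simp [vec, this]
  · intro h
    simp [he] at h

/-- An acyclic matching on the enhanced states: the states in `A` are matched with those in `B` by
adding an edge, the states in `K` are critical, and a rank shows acyclicity. -/
structure Matching (A B : ℕ → EnhancedState Γ v₀ → Prop) (K : EnhancedState Γ v₀ → Prop) :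
    Prop where
  cover : ∀ S, (∃ p, A p S) ∨ (∃ p, B p S) ∨ K S
  disjoint_left : ∀ p q S, B p S → ¬ A q S
  disjoint_right : ∀ p S, B p S → ¬ K S
  disjoint_critical : ∀ p S, A p S → ¬ K S
  -- The other upper states in the differential of `S` have smaller rank, so `T` can be eliminated
  -- by induction on the rank.
  down : ∀ p T, B p T → ∃ S e, (∃ q, A q S) ∧ e.1 ∉ S.edges ∧ S.addEdge e = some T ∧
    ∀ f, f.1 ∉ S.edges → f ≠ e → ∀ q T', S.addEdge f = some T' → B q T' → q < p
  -- Any other lower state with `T` in its differential has larger rank, so a lower state of maximal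
  -- rank in a cochain cannot be cancelled at `T`.
  up : ∀ p S, A p S → ∃ e T q, e.1 ∉ S.edges ∧ S.addEdge e = some T ∧ B q T ∧
    ∀ p' S' f, A p' S' → f.1 ∉ S'.edges → S'.addEdge f = some T → S' = S ∧ f = e ∨ p < p'

/-! ### Cohomology from an acyclic matching -/

namespace Matching

variable {A B : ℕ → EnhancedState Γ v₀ → Prop} {K : EnhancedState Γ v₀ → Prop}

/-- Only the upper states need an argument. If `T` is matched with `S`, then the differential of `S`
is `±T` plus lower states, critical states and upper states of smaller rank; solving for `T` gives a
strong induction on the rank. -/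
theorem cochains_le (M : Matching A B K) (i j : ℤ) :
    cochains Γ v₀ i j ≤
      (stateSpan (fun S => (S.dim = i ∧ S.degree = j) ∧ ∃ p, A p S) ⊔
        (stateSpan fun S => (S.dim = i - 1 ∧ S.degree = j) ∧ ∃ p, A p S).map (diff Γ v₀)) ⊔
      stateSpan (fun S => (S.dim = i ∧ S.degree = j) ∧ K S) := by
  classical
  let _ := Fintype.ofFinite E(Γ)
  set W := (stateSpan (fun S => (S.dim = i ∧ S.degree = j) ∧ ∃ p, A p S) ⊔
        (stateSpan fun S => (S.dim = i - 1 ∧ S.degree = j) ∧ ∃ p, A p S).map (diff Γ v₀)) ⊔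
      stateSpan (fun S => (S.dim = i ∧ S.degree = j) ∧ K S) with hW
  have hA : ∀ S : EnhancedState Γ v₀, S.dim = i ∧ S.degree = j → (∃ p, A p S) →
      stateBasis Γ v₀ S ∈ W := fun S h k =>
    Submodule.mem_sup_left (Submodule.mem_sup_left (stateBasis_mem_stateSpan ⟨h, k⟩))
  have hK : ∀ S : EnhancedState Γ v₀, S.dim = i ∧ S.degree = j → K S →
      stateBasis Γ v₀ S ∈ W := fun S h k =>
    Submodule.mem_sup_right (stateBasis_mem_stateSpan ⟨h, k⟩)
  have hB : ∀ p, ∀ T : EnhancedState Γ v₀, T.dim = i ∧ T.degree = j → B p T →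
      stateBasis Γ v₀ T ∈ W := by
    intro p
    induction p using Nat.strong_induction_on with
    | _ p ih =>
      intro T hT hBT
      obtain ⟨S, e, hAS, he, hST, hf⟩ := M.down p T hBT
      have hb := EnhancedState.addEdge_bidegree he hST
      have hd : diff Γ v₀ (stateBasis Γ v₀ S) ∈ W :=
        Submodule.mem_sup_left (Submodule.mem_sup_right
          ⟨_, stateBasis_mem_stateSpan ⟨⟨by omega, by omega⟩, hAS⟩, rfl⟩)
      rw [diff_stateBasis, ← Finset.add_sum_erase _ _
        (Finset.mem_filter.2 ⟨Finset.mem_univ e, he⟩)] at hd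
      have hs : ∑ f ∈ (Finset.univ.filter fun f : E(Γ) => f.1 ∉ S.edges).erase e,
          S.sign f.1 • vec (S.addEdge f) ∈ W := by
        refine Submodule.sum_mem _ fun f hfm => Submodule.smul_mem _ _ ?_
        obtain ⟨hfe, hfm⟩ := Finset.mem_erase.1 hfm
        have hfS := (Finset.mem_filter.1 hfm).2
        cases hU : S.addEdge f with
        | none => exact Submodule.zero_mem _
        | some U =>
          have hbU := EnhancedState.addEdge_bidegree hfS hU
          have hU' : U.dim = i ∧ U.degree = j := ⟨by omega, by omega⟩
          rcases M.cover U with h | ⟨q, h⟩ | h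
          · exact hA U hU' h
          · exact ih q (hf f hfS hfe q U hU h) U hU' h
          · exact hK U hU' h
      have := (Submodule.add_mem_iff_left _ hs).1 hd
      rw [hST] at this
      exact (Submodule.smul_mem_iff _ (S.sign_ne_zero e.1)).1 this
  rw [cochains_eq_stateSpan]
  refine Submodule.span_le.2 ?_
  rintro _ ⟨S, hS, rfl⟩
  rcases M.cover S with h | ⟨p, h⟩ | h
  · exact hA S hS h
  · exact hB p S hS h
  · exact hK S hS h

/-- In a nonzero combination of lower states, take `S` of maximal rank and its partner `T`. By `up`,
no other state of the support contributes to the coefficient of `T` in the differential, so this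
coefficient is nonzero although `T` is an upper state. -/
theorem eq_zero_of_diff_mem (M : Matching A B K) {c : Chain Γ v₀}
    (hc : c ∈ stateSpan fun S => ∃ p, A p S)
    (hd : diff Γ v₀ c ∈ stateSpan fun S => (∃ p, A p S) ∨ K S) : c = 0 := by
  classical
  rw [mem_stateSpan_iff] at hc hd
  by_contra hne
  set r := (stateBasis Γ v₀).repr c with hr
  have hr0 : r ≠ 0 := by simpa [hr] using hne
  -- The rank of a lower state need not be unique, so one is chosen; outside the support the value
  -- is a dummy.
  have hrank : ∀ S, ∃ p, r S ≠ 0 → A p S := fun S => by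
    by_cases h : r S = 0
    · exact ⟨0, fun k => absurd h k⟩
    · exact (hc S h).imp fun p hp _ => hp
  choose rk hrk using hrank
  obtain ⟨S, hS, hmax⟩ := Finset.exists_max_image r.support rk (Finsupp.support_nonempty_iff.2 hr0)
  have hS' := Finsupp.mem_support_iff.1 hS
  obtain ⟨e, T, q, he, hT, hBT, hu⟩ := M.up _ S (hrk S hS')
  have hz : (stateBasis Γ v₀).repr (diff Γ v₀ c) T = 0 := by
    by_contra h
    rcases hd T h with ⟨p, h⟩ | h
    · exact M.disjoint_left _ _ _ hBT h
    · exact M.disjoint_right _ _ hBT h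
  have hsum : c = ∑ U ∈ r.support, r U • stateBasis Γ v₀ U := by
    conv_lhs => rw [← (stateBasis Γ v₀).linearCombination_repr c]
    rw [Finsupp.linearCombination_apply, Finsupp.sum]
  rw [hsum, map_sum, map_sum, Finsupp.finsetSum_apply, Finset.sum_eq_single S] at hz
  · rw [map_smul, map_smul, Finsupp.smul_apply, repr_diff_eq_sign he hT] at hz
    · exact (mul_ne_zero hS' (S.sign_ne_zero e.1)) hz
    · intro f hf hfT
      rcases hu _ S f (hrk S hS') hf hfT with h | h
      · exact h.2
      · exact absurd h (lt_irrefl _)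
  · intro U hU hUS
    rw [map_smul, map_smul, Finsupp.smul_apply, repr_diff_eq_zero, smul_zero]
    intro f hf hfT
    rcases hu _ U f (hrk U (Finsupp.mem_support_iff.1 hU)) hf hfT with h | h
    · exact hUS h.1
    · exact absurd (hmax U hU) (not_le.2 h)
  · intro h
    exact absurd hS h

theorem exists_of_mem_cochains (M : Matching A B K) {i j : ℤ} {c : Chain Γ v₀}
    (hc : c ∈ cochains Γ v₀ i j) :
    ∃ a ∈ stateSpan (fun S => (S.dim = i ∧ S.degree = j) ∧ ∃ p, A p S),
    ∃ b ∈ stateSpan (fun S => (S.dim = i - 1 ∧ S.degree = j) ∧ ∃ p, A p S),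
    ∃ t ∈ stateSpan (fun S => (S.dim = i ∧ S.degree = j) ∧ K S), c = a + diff Γ v₀ b + t := by
  obtain ⟨y, hy, t, ht, rfl⟩ := Submodule.mem_sup.1 (M.cochains_le i j hc)
  obtain ⟨a, ha, _, ⟨b, hb, rfl⟩, rfl⟩ := Submodule.mem_sup.1 hy
  exact ⟨a, ha, b, hb, t, ht, rfl⟩

theorem exists_of_mem_cochains_of_forall_not (M : Matching A B K) {i j : ℤ}
    (hK : ∀ S : EnhancedState Γ v₀, S.dim = i → S.degree = j → ¬ K S) {c : Chain Γ v₀}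
    (hc : c ∈ cochains Γ v₀ i j) :
    ∃ a ∈ stateSpan (fun S => (S.dim = i ∧ S.degree = j) ∧ ∃ p, A p S),
    ∃ b ∈ stateSpan (fun S => (S.dim = i - 1 ∧ S.degree = j) ∧ ∃ p, A p S),
      c = a + diff Γ v₀ b := by
  obtain ⟨a, ha, b, hb, t, ht, rfl⟩ := M.exists_of_mem_cochains hc
  refine ⟨a, ha, b, hb, ?_⟩
  have : t = 0 := by
    rw [← (stateBasis Γ v₀).repr.map_eq_zero_iff]
    ext S
    by_contra h
    obtain ⟨h₁, h₂⟩ := mem_stateSpan_iff.1 ht S h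
    exact hK S h₁.1 h₁.2 h₂
  rw [this, add_zero]

/-- A cochain without critical or upper states that is a cocycle vanishes. -/
theorem eq_zero_of_diff_eq_zero (M : Matching A B K) {c : Chain Γ v₀}
    (hc : c ∈ stateSpan fun S => ∃ p, A p S) (hd : diff Γ v₀ c = 0) : c = 0 :=
  M.eq_zero_of_diff_mem hc (hd ▸ Submodule.zero_mem _)

/-- The cocycles of a bidegree without critical states are coboundaries of lower states. -/
theorem exists_diff_eq (M : Matching A B K) {i j : ℤ}
    (hK : ∀ S : EnhancedState Γ v₀, S.dim = i → S.degree = j → ¬ K S) {c : Chain Γ v₀}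
    (hc : c ∈ cochains Γ v₀ i j) (hd : diff Γ v₀ c = 0) :
    ∃ b ∈ stateSpan (fun S => (S.dim = i - 1 ∧ S.degree = j) ∧ ∃ p, A p S), diff Γ v₀ b = c := by
  obtain ⟨a, ha, b, hb, rfl⟩ := M.exists_of_mem_cochains_of_forall_not hK hc
  rw [map_add, diff_diff, add_zero] at hd
  refine ⟨b, hb, ?_⟩
  rw [M.eq_zero_of_diff_eq_zero (stateSpan_mono (fun S h => h.2) ha) hd, zero_add]

/-- The cohomology vanishes in a bidegree without critical states. -/
theorem subsingleton_reducedCohomology (M : Matching A B K) {i j : ℤ}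
    (hK : ∀ S : EnhancedState Γ v₀, S.dim = i → S.degree = j → ¬ K S) :
    Subsingleton (ReducedCohomology Γ v₀ i j) := by
  rw [Submodule.Quotient.subsingleton_iff, eq_top_iff]
  rintro ⟨c, hc, hd⟩ -
  obtain ⟨b, hb, rfl⟩ := M.exists_diff_eq hK hc hd
  exact ⟨b, stateSpan_le_cochains hb, rfl⟩

/-- The cohomology is one-dimensional in a bidegree with exactly one critical state, if there are no
critical states in the adjacent bidegrees. -/
theorem nonempty_reducedCohomology_equiv (M : Matching A B K) {i j : ℤ} {T : EnhancedState Γ v₀}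
    (hT : T.dim = i ∧ T.degree = j) (hTK : K T)
    (hK : ∀ S : EnhancedState Γ v₀, S.dim = i → S.degree = j → K S → S = T)
    (hpred : ∀ S : EnhancedState Γ v₀, S.dim = i - 1 → S.degree = j → ¬ K S)
    (hsucc : ∀ S : EnhancedState Γ v₀, S.dim = i + 1 → S.degree = j → ¬ K S) :
    Nonempty (ReducedCohomology Γ v₀ i j ≃ₗ[ℝ] ℝ) := by
  set t := stateBasis Γ v₀ T with ht
  have htc : t ∈ cochains Γ v₀ i j := by
    rw [cochains_eq_stateSpan]
    exact stateBasis_mem_stateSpan hT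
  -- The critical state need not be a cocycle. Its differential is a cocycle in a bidegree without
  -- critical states, hence the differential of some `a` made of lower states, and `t - a` is the
  -- generator sought.
  obtain ⟨a, ha, hat⟩ := M.exists_diff_eq hsucc (diff_mem_cochains htc) (diff_diff t)
  rw [add_sub_cancel_right] at ha
  have haA := stateSpan_mono (fun S h => h.2) ha
  have hzd : diff Γ v₀ (t - a) = 0 := by rw [map_sub, hat, sub_self]
  have hz : t - a ∈ cocycles Γ v₀ i j :=
    ⟨Submodule.sub_mem _ htc (stateSpan_le_cochains ha), hzd⟩
  refine ⟨(LinearEquiv.ofBijective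
    (LinearMap.toSpanSingleton ℝ (ReducedCohomology Γ v₀ i j)
      (Submodule.Quotient.mk ⟨t - a, hz⟩)) ⟨?_, ?_⟩).symm⟩
  · rw [← LinearMap.ker_eq_bot, LinearMap.ker_toSpanSingleton]
    intro h
    rw [Submodule.Quotient.mk_eq_zero] at h
    obtain ⟨y, hy, hyz⟩ : t - a ∈ coboundaries Γ v₀ i j := h
    obtain ⟨a', ha', b, -, rfl⟩ := M.exists_of_mem_cochains_of_forall_not hpred hy
    rw [map_add, diff_diff, add_zero] at hyz
    -- The differential of `a'` is `t - a`, which contains no upper state.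
    have h0 : a' = 0 := by
      refine M.eq_zero_of_diff_mem (stateSpan_mono (fun S h => h.2) ha') ?_
      rw [hyz]
      exact Submodule.sub_mem _ (stateBasis_mem_stateSpan (Or.inr hTK))
        (stateSpan_mono (fun S h => Or.inl h) haA)
    rw [h0, map_zero, eq_comm, sub_eq_zero] at hyz
    rw [← hyz] at haA
    obtain ⟨p, hp⟩ := mem_stateSpan_iff.1 haA T (by simp [ht])
    exact M.disjoint_critical p T hp hTK
  · intro q
    induction q using Submodule.Quotient.induction_on with
    | H c =>
      obtain ⟨c, hc, hd⟩ := c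
      obtain ⟨a', ha', b, hb, s, hs, hceq⟩ := M.exists_of_mem_cochains hc
      obtain ⟨x, rfl⟩ : ∃ x : ℝ, x • t = s := by
        refine Submodule.mem_span_singleton.1 (Submodule.span_mono ?_ hs)
        rintro _ ⟨S, hS, rfl⟩
        rw [hK S hS.1.1 hS.1.2 hS.2]
        rfl
      refine ⟨x, ?_⟩
      rw [LinearMap.toSpanSingleton_apply, ← Submodule.Quotient.mk_smul, eq_comm,
        Submodule.Quotient.eq]
      -- This is a combination of lower states that differs from `c - x • (t - a)` by a coboundary,
      -- hence a cocycle.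
      have h0 : a' + x • a = 0 := by
        refine M.eq_zero_of_diff_eq_zero (Submodule.add_mem _ (stateSpan_mono (fun S h => h.2) ha')
          (Submodule.smul_mem _ _ haA)) ?_
        have : a' + x • a = c - diff Γ v₀ b - x • (t - a) := by
          rw [hceq, smul_sub]
          abel
        rw [this, map_sub, map_sub, map_smul, hzd, diff_diff, show diff Γ v₀ c = 0 from hd]
        simp
      refine ⟨b, stateSpan_le_cochains hb, ?_⟩
      change diff Γ v₀ b = c - x • (t - a)
      rw [hceq, smul_sub, ← sub_eq_zero]
      rw [← neg_eq_zero, ← h0]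
      abel

end Matching

end Matching

/-! ### Labelings of a cycle -/

/-- A labeling of the vertices and edges of a cycle with `n` vertices by natural numbers, starting
at the base vertex. -/
structure CycleLabeling (Γ : Graph α β) (v₀ : V(Γ)) (n : ℕ) where
  v : ℕ → V(Γ)
  e : ℕ → E(Γ)
  pos : 1 ≤ n
  v_zero : v 0 = v₀
  v_last : v n = v₀
  v_inj : ∀ l < n, ∀ l' < n, v l = v l' → l = l'
  v_surj : ∀ w, ∃ l < n, v l = w
  e_inj : ∀ l < n, ∀ l' < n, e l = e l' → l = l'
  e_surj : ∀ f, ∃ l < n, e l = f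
  link : ∀ l, Γ.IsLink (e l) (v l) (v (l + 1))

/-- A translation of `ZMod n` moves the index of the base vertex to `0`. -/
theorem IsCycleGraph.nonempty_labeling {n : ℕ} (h : IsCycleGraph Γ n) (hn : 1 ≤ n) (v₀ : V(Γ)) :
    Nonempty (CycleLabeling Γ v₀ n) := by
  obtain ⟨a, b, hab⟩ := h
  have : NeZero n := ⟨by omega⟩
  have inj : ∀ l < n, ∀ l' < n, (l : ZMod n) + a.symm v₀ = (l' : ZMod n) + a.symm v₀ → l = l' := by
    intro l hl l' hl' h
    have h := (ZMod.natCast_eq_natCast_iff' l l' n).1 (add_right_cancel h)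
    rwa [Nat.mod_eq_of_lt hl, Nat.mod_eq_of_lt hl'] at h
  have surj : ∀ z : ZMod n, ∃ l < n, (l : ZMod n) + a.symm v₀ = z := fun z =>
    ⟨(z - a.symm v₀).val, ZMod.val_lt _, by simp⟩
  exact ⟨{
    v := fun l => a (l + a.symm v₀)
    e := fun l => b (l + a.symm v₀)
    pos := hn
    v_zero := by simp
    v_last := by simp
    v_inj := fun l hl l' hl' h => inj l hl l' hl' (a.injective h)
    v_surj := fun w => (surj (a.symm w)).imp fun l h => ⟨h.1, by simp [h.2]⟩
    e_inj := fun l hl l' hl' h => inj l hl l' hl' (b.injective h)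
    e_surj := fun f => (surj (b.symm f)).imp fun l h => ⟨h.1, by simp [h.2]⟩
    link := fun l => by
      have := hab (l + a.symm v₀)
      convert this using 3
      push_cast
      ring }⟩

/-! ### Connectivity and colors along the cycle -/

namespace EnhancedState

theorem Conn.refl (S : EnhancedState Γ v₀) (w : V(Γ)) : S.Conn w w :=
  (connSetoid Γ S.edges).refl w

theorem Conn.symm {S : EnhancedState Γ v₀} {u w : V(Γ)} (h : S.Conn u w) : S.Conn w u :=
  (connSetoid Γ S.edges).symm h

theorem Conn.trans {S : EnhancedState Γ v₀} {u w z : V(Γ)} (h : S.Conn u w) (k : S.Conn w z) :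
    S.Conn u z :=
  (connSetoid Γ S.edges).trans h k

theorem colorAt_base (S : EnhancedState Γ v₀) : S.colorAt v₀ = Color.x :=
  S.color_base

theorem color_eq_one_of_ne {c : Color} (h : c ≠ Color.x) : c = Color.one := by
  cases c
  · rfl
  · exact absurd rfl h

/-- Adding an edge between a component of color `1` and any component gives a nonzero result. -/
theorem exists_addEdge_eq_some {S : EnhancedState Γ v₀} {e : E(Γ)}
    (h : ∀ u w : V(Γ), Γ.IsLink e u w → S.colorAt u = Color.x → S.colorAt w = Color.x → S.Conn u w) :
    ∃ T, S.addEdge e = some T := by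
  cases hT : S.addEdge e with
  | none =>
    obtain ⟨u, w, hu, hw, hn, hl⟩ := addEdge_none hT
    exact absurd (h u w hl hu hw) hn
  | some T => exact ⟨T, rfl⟩

end EnhancedState

namespace CycleLabeling

open EnhancedState

variable {n : ℕ} (L : CycleLabeling Γ v₀ n)

/-- The state `S` contains the `l`-th edge. -/
def Has (S : EnhancedState Γ v₀) (l : ℕ) : Prop := (L.e l).1 ∈ S.edges

theorem edges_eq_of_has {S T : EnhancedState Γ v₀} (h : ∀ l < n, L.Has S l ↔ L.Has T l) :
    S.edges = T.edges := by
  ext f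
  constructor
  · intro hf
    obtain ⟨l, hl, hlf⟩ := L.e_surj ⟨f, S.edges_subset hf⟩
    have := (h l hl).1 (by unfold Has; rwa [hlf])
    unfold Has at this
    rwa [hlf] at this
  · intro hf
    obtain ⟨l, hl, hlf⟩ := L.e_surj ⟨f, T.edges_subset hf⟩
    have := (h l hl).2 (by unfold Has; rwa [hlf])
    unfold Has at this
    rwa [hlf] at this

theorem has_addEdge {S T : EnhancedState Γ v₀} {l : ℕ} (hl : l < n)
    (h : S.addEdge (L.e l) = some T) {l' : ℕ} (hl' : l' < n) :
    L.Has T l' ↔ l' = l ∨ L.Has S l' := by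
  unfold Has
  rw [(addEdge_some h).1]
  refine or_congr_left ⟨fun k => L.e_inj _ hl' _ hl (Subtype.ext k), ?_⟩
  rintro rfl
  rfl

/-- The edges at the `k`-th vertex are the `k`-th and the `(k-1)`-st one. -/
theorem eq_or_eq_of_isLink {k l : ℕ} (hk : 1 ≤ k) (hkn : k < n) (hl : l < n) {w : V(Γ)}
    (h : Γ.IsLink (L.e l) (L.v k) w) : l = k ∧ w = L.v (k + 1) ∨ l = k - 1 ∧ w = L.v (k - 1) := by
  rcases (L.link l).eq_and_eq_or_eq_and_eq h with ⟨h₁, h₂⟩ | ⟨h₁, h₂⟩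
  · have := L.v_inj _ hl _ hkn (Subtype.ext h₁)
    subst this
    exact Or.inl ⟨rfl, (Subtype.ext h₂).symm⟩
  · have h₂ := Subtype.ext h₂
    rcases Nat.lt_or_ge (l + 1) n with hln | hln
    · have := L.v_inj _ hln _ hkn h₂
      subst this
      exact Or.inr ⟨rfl, (Subtype.ext h₁).symm⟩
    · have hln : l + 1 = n := by omega
      rw [hln, L.v_last] at h₂
      have := L.v_inj 0 (by omega) _ hkn (L.v_zero.trans h₂)
      omega

/-- Both edges at the `k`-th vertex are missing, so this vertex is isolated. The bound `1 ≤ k`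
excludes the base vertex, where the numbering closes up. -/
theorem eq_of_conn {S : EnhancedState Γ v₀} {k : ℕ} (hk : 1 ≤ k) (hkn : k < n)
    (h₁ : ¬ L.Has S k) (h₂ : ¬ L.Has S (k - 1)) {u : V(Γ)} (h : S.Conn u (L.v k)) :
    u = L.v k := by
  suffices H : ∀ u w, S.Conn u w → (u = L.v k ↔ w = L.v k) from (H _ _ h).2 rfl
  have key : ∀ f ∈ S.edges, ∀ w : V(Γ), ¬ Γ.IsLink f (L.v k) w := by
    intro f hf w hl
    obtain ⟨l, hln, hlf⟩ := L.e_surj ⟨f, hl.edge_mem⟩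
    have hlf : (L.e l).1 = f := congrArg Subtype.val hlf
    subst hlf
    rcases L.eq_or_eq_of_isLink hk hkn hln hl with ⟨rfl, -⟩ | ⟨rfl, -⟩
    · exact h₁ hf
    · exact h₂ hf
  intro u w huw
  induction huw with
  | rel u w h =>
    obtain ⟨f, hf, hl⟩ := h
    constructor
    · rintro rfl
      exact absurd hl (key f hf w)
    · rintro rfl
      exact absurd hl.symm (key f hf u)
  | refl => rfl
  | symm _ _ _ ih => exact ih.symm
  | trans _ _ _ _ _ ih₁ ih₂ => exact ih₁.trans ih₂

/-- If a state has all edges after the `m`-th one, then the later vertices are connected to the base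
vertex. -/
theorem conn_base {S : EnhancedState Γ v₀} {m : ℕ} (h : ∀ l, m < l → l < n → L.Has S l) {l : ℕ}
    (hl : m < l) (hln : l ≤ n) : S.Conn (L.v l) v₀ := by
  induction hln using Nat.decreasingInduction with
  | self => rw [L.v_last]; exact Conn.refl _ _
  | of_succ l hln ih =>
    exact (S.conn_of_isLink (h l hl hln) (L.link l)).trans (ih (by omega))

/-- At most the edge `0` is missing, and the remaining path is still spanning. This is the case `m =
0` of the matching. -/
theorem conn_base_of_forall {S : EnhancedState Γ v₀} (h : ∀ l, 0 < l → l < n → L.Has S l)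
    (w : V(Γ)) : S.Conn w v₀ := by
  obtain ⟨l, hl, rfl⟩ := L.v_surj w
  rcases Nat.eq_zero_or_pos l with rfl | hl0
  · rw [L.v_zero]
    exact Conn.refl _ _
  · exact L.conn_base h hl0 hl.le

theorem colorAt_of_forall {S : EnhancedState Γ v₀} (h : ∀ l, 0 < l → l < n → L.Has S l)
    (w : V(Γ)) : S.colorAt w = Color.x :=
  (S.colorAt_eq_of_conn (L.conn_base_of_forall h w)).trans S.colorAt_base

/-! ### The matching -/

/-- The state `S` has all edges after the `m`-th one, but not those from the `k`-th to the `m`-th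
one, and the isolated vertices after the `k`-th one have color `x`. -/
structure IsPattern (m k : ℕ) (S : EnhancedState Γ v₀) : Prop where
  lt : m < n
  -- With `m = 0` and `k = 1` the edge `k - 1` to be added or removed is the edge `0`, and the
  -- conditions from `k` to `m` are empty.
  index : 1 ≤ k ∧ k ≤ m ∨ m = 0 ∧ k = 1
  has : ∀ l, m < l → l < n → L.Has S l
  not_has : ∀ l, k ≤ l → l ≤ m → ¬ L.Has S l
  color : ∀ l, k < l → l ≤ m → S.colorAt (L.v l) = Color.x

/-- The states that are matched with a state with one more edge. -/
structure IsLower (m k : ℕ) (S : EnhancedState Γ v₀) : Prop extends L.IsPattern m k S where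
  not_has_pred : ¬ L.Has S (k - 1)
  -- For `m = 0` every vertex lies in the base component and has color `x`, so there is nothing to
  -- require.
  color_one : 1 ≤ m → S.colorAt (L.v k) = Color.one

/-- The states that are matched with a state with one edge less. -/
structure IsUpper (m k : ℕ) (S : EnhancedState Γ v₀) : Prop extends L.IsPattern m k S where
  has_pred : L.Has S (k - 1)

/-- The critical states. -/
structure IsCritical (m : ℕ) (S : EnhancedState Γ v₀) : Prop where
  pos : 1 ≤ m
  lt : m < n
  has_iff : ∀ l < n, L.Has S l ↔ m < l
  color : ∀ w, S.colorAt w = Color.x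

variable {L}

/-- The larger of two different values would index an edge that one pattern contains and the other
lacks. -/
theorem IsPattern.top_unique {m k m' k' : ℕ} {S : EnhancedState Γ v₀} (h : L.IsPattern m k S)
    (h' : L.IsPattern m' k' S) : m = m' := by
  rcases lt_trichotomy m m' with hlt | heq | hlt
  · refine absurd (h.has m' hlt h'.lt) (h'.not_has m' ?_ le_rfl)
    have := h'.index
    omega
  · exact heq
  · refine absurd (h'.has m hlt h.lt) (h.not_has m ?_ le_rfl)
    have := h.index
    omega

/-- A pattern at `k` lacks the edges from `k` to `m`, and the edge `k' - 1` is present. -/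
theorem IsUpper.index_le {m k m' k' : ℕ} {S : EnhancedState Γ v₀} (h : L.IsPattern m k S)
    (h' : L.IsUpper m' k' S) : k' ≤ k := by
  have := h.top_unique h'.toIsPattern
  by_contra hlt
  have i₁ := h.index
  have i₂ := h'.index
  exact h.not_has (k' - 1) (by omega) (by omega) h'.has_pred

theorem IsUpper.unique {m k m' k' : ℕ} {S : EnhancedState Γ v₀} (h : L.IsUpper m k S)
    (h' : L.IsUpper m' k' S) : m = m' ∧ k = k' :=
  ⟨h.top_unique h'.toIsPattern,
    le_antisymm (IsUpper.index_le h'.toIsPattern h) (IsUpper.index_le h.toIsPattern h')⟩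

/-- The values of `m` agree and `k' ≤ k`. If they are equal, the edge `k - 1` would be both present
and missing; if `k' < k`, the `k`-th vertex would have both colors. -/
theorem IsUpper.not_isLower {m k m' k' : ℕ} {S : EnhancedState Γ v₀} (h' : L.IsUpper m' k' S) :
    ¬ L.IsLower m k S := by
  intro h
  have hm := h.top_unique h'.toIsPattern
  subst hm
  have hk := IsUpper.index_le h.toIsPattern h'
  have i₁ := h.index
  have i₂ := h'.index
  rcases hk.eq_or_lt with rfl | hk
  · exact h.not_has_pred h'.has_pred
  · have h₁ := h'.color k hk (by omega)
    rw [h.color_one (by omega)] at h₁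
    cases h₁

theorem IsCritical.not_isUpper {m m' k' : ℕ} {S : EnhancedState Γ v₀} (h : L.IsCritical m S) :
    ¬ L.IsUpper m' k' S := by
  intro h'
  have i := h'.index
  have hlt := h.lt
  have hlt' := h'.lt
  have h₁ := (h.has_iff (k' - 1) (by omega)).1 h'.has_pred
  exact h'.not_has m' (by omega) le_rfl ((h.has_iff m' hlt').2 (by omega))

theorem IsCritical.not_isLower {m m' k' : ℕ} {S : EnhancedState Γ v₀} (h : L.IsCritical m S) :
    ¬ L.IsLower m' k' S := by
  intro h'
  rcases Nat.eq_zero_or_pos m' with rfl | hm'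
  · exact lt_irrefl _ ((h.has_iff m h.lt).1 (h'.has m h.pos h.lt))
  · have := h'.color_one hm'
    rw [h.color] at this
    cases this

theorem IsCritical.unique {m : ℕ} {S T : EnhancedState Γ v₀} (hS : L.IsCritical m S)
    (hT : L.IsCritical m T) : S = T :=
  ext_of_colorAt (L.edges_eq_of_has fun l hl => (hS.has_iff l hl).trans (hT.has_iff l hl).symm)
    fun w => (hS.color w).trans (hT.color w).symm

variable (L) in
theorem isLower_or_isUpper_or_isCritical (S : EnhancedState Γ v₀) :
    (∃ m k, L.IsLower m k S) ∨ (∃ m k, L.IsUpper m k S) ∨ ∃ m, L.IsCritical m S := by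
  classical
  have hn := L.pos
  -- `Nat.findGreatest` returns `0` also when no edge is missing, so the edge `m` is known to be
  -- missing only for `m ≥ 1`.
  obtain ⟨m, hmn, hm, hmS⟩ : ∃ m < n, (∀ l, m < l → l < n → L.Has S l) ∧
      (1 ≤ m → ¬ L.Has S m) := by
    refine ⟨Nat.findGreatest (fun l => ¬ L.Has S l) (n - 1), ?_, fun l hl hln => ?_, fun h => ?_⟩
    · have := Nat.findGreatest_le (P := fun l => ¬ L.Has S l) (n - 1)
      omega
    · exact not_not.1 (Nat.findGreatest_is_greatest hl (by omega))
    · exact Nat.findGreatest_of_ne_zero (P := fun l => ¬ L.Has S l) rfl (Nat.one_le_iff_ne_zero.1 h)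
  rcases Nat.eq_zero_or_pos m with rfl | hm0
  · have hp : L.IsPattern 0 1 S := ⟨hmn, by simp, hm, fun l _ _ => by omega, fun l _ _ => by omega⟩
    by_cases h0 : L.Has S 0
    · exact Or.inr (Or.inl ⟨0, 1, hp, h0⟩)
    · exact Or.inl ⟨0, 1, hp, h0, by omega⟩
  -- `P l` says that the descent from `m` stops at `l`. The default value `k = 0` means that it
  -- never stops at a positive index, which is the critical case.
  · set P : ℕ → Prop := fun l => ¬ (¬ L.Has S (l - 1) ∧ S.colorAt (L.v l) = Color.x) with hP
    obtain ⟨k, hkm, hk, hkP⟩ : ∃ k ≤ m, (∀ l, k < l → l ≤ m → ¬ P l) ∧ (k ≠ 0 → P k) :=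
      ⟨Nat.findGreatest P m, Nat.findGreatest_le m,
        fun l hl hlm => Nat.findGreatest_is_greatest hl hlm,
        fun h => Nat.findGreatest_of_ne_zero rfl h⟩
    have hk' : ∀ l, k < l → l ≤ m → ¬ L.Has S (l - 1) ∧ S.colorAt (L.v l) = Color.x :=
      fun l h₁ h₂ => not_not.1 (hk l h₁ h₂)
    have hnot : ∀ l, k ≤ l → l ≤ m → ¬ L.Has S l := by
      intro l h₁ h₂
      rcases h₂.eq_or_lt with rfl | h₂
      · exact hmS hm0
      · exact (hk' (l + 1) (by omega) h₂).1
    rcases Nat.eq_zero_or_pos k with rfl | hk0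
    · refine Or.inr (Or.inr ⟨m, hm0, hmn, fun l hl => ⟨fun h => ?_, fun h => hm l h hl⟩,
        fun w => ?_⟩)
      · by_contra hlm
        exact hnot l (by omega) (by omega) h
      · obtain ⟨l, hl, rfl⟩ := L.v_surj w
        rcases Nat.eq_zero_or_pos l with rfl | hl0
        · rw [L.v_zero, S.colorAt_base]
        · rcases Nat.lt_or_ge m l with h | h
          · rw [S.colorAt_eq_of_conn (L.conn_base hm h hl.le), S.colorAt_base]
          · exact (hk' l hl0 h).2
    · have hp : L.IsPattern m k S :=
        ⟨hmn, Or.inl ⟨hk0, hkm⟩, hm, hnot, fun l h₁ h₂ => (hk' l h₁ h₂).2⟩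
      by_cases h0 : L.Has S (k - 1)
      · exact Or.inr (Or.inl ⟨m, k, hp, h0⟩)
      · refine Or.inl ⟨m, k, hp, h0, fun _ => color_eq_one_of_ne fun h => ?_⟩
        exact hkP (by omega) ⟨h0, h⟩

/-! ### Adding and removing the matched edge -/

/-- The product is zero only for two distinct components of color `x`. For `m ≥ 1` one end of the
edge has color `1`, and for `m = 0` the ends are already connected. -/
theorem IsLower.exists_addEdge {m k : ℕ} {S : EnhancedState Γ v₀} (h : L.IsLower m k S) :
    ∃ T, S.addEdge (L.e (k - 1)) = some T := by
  refine exists_addEdge_eq_some fun u w hl hu hw => ?_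
  have hmn := h.lt
  rcases h.index with ⟨h₁, h₂⟩ | ⟨rfl, rfl⟩
  · have hc := h.color_one (h₁.trans h₂)
    have hlk := L.link (k - 1)
    rw [Nat.sub_add_cancel h₁] at hlk
    rcases hlk.eq_and_eq_or_eq_and_eq hl with ⟨-, h₃⟩ | ⟨-, h₃⟩
    · rw [← Subtype.ext h₃, hc] at hw
      cases hw
    · rw [← Subtype.ext h₃, hc] at hu
      cases hu
  · exact (L.conn_base_of_forall h.has u).trans (L.conn_base_of_forall h.has w).symm

/-- The color of an isolated vertex does not change if an edge is added elsewhere. -/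
theorem colorAt_addEdge {S T : EnhancedState Γ v₀} {f : E(Γ)} (h : S.addEdge f = some T) {k : ℕ}
    (hk : 1 ≤ k) (hkn : k < n) (h₁ : ¬ L.Has T k) (h₂ : ¬ L.Has T (k - 1)) :
    T.colorAt (L.v k) = S.colorAt (L.v k) := by
  have hx : T.colorAt (L.v k) = Color.x ↔ S.colorAt (L.v k) = Color.x := by
    rw [(addEdge_some h).2.color]
    constructor
    · rintro ⟨u, hu, hc⟩
      rwa [L.eq_of_conn hk hkn h₁ h₂ hu] at hc
    · exact fun hc => ⟨_, Conn.refl _ _, hc⟩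
  by_cases hc : S.colorAt (L.v k) = Color.x
  · rw [hc, hx.2 hc]
  · rw [color_eq_one_of_ne hc, color_eq_one_of_ne fun h => hc (hx.1 h)]

theorem IsLower.isUpper {m k : ℕ} {S T : EnhancedState Γ v₀} (h : L.IsLower m k S)
    (hT : S.addEdge (L.e (k - 1)) = some T) : L.IsUpper m k T := by
  have hmn := h.lt
  have i := h.index
  have hh : ∀ {l}, l < n → (L.Has T l ↔ l = k - 1 ∨ L.Has S l) :=
    fun hl => L.has_addEdge (by omega) hT hl
  refine ⟨⟨hmn, i, fun l h₁ h₂ => (hh h₂).2 (Or.inr (h.has l h₁ h₂)), fun l h₁ h₂ k' => ?_,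
    fun l h₁ h₂ => ?_⟩, (hh (by omega)).2 (Or.inl rfl)⟩
  · rcases (hh (by omega)).1 k' with rfl | h₃
    · omega
    · exact h.not_has l h₁ h₂ h₃
  · exact ((addEdge_some hT).2.color _).2 ⟨_, Conn.refl _ _, h.color l h₁ h₂⟩

/-- Adding any edge but the matched one increases the matching index. -/
theorem IsLower.lt_of_isUpper {m k m' k' l : ℕ} {S T : EnhancedState Γ v₀} (h : L.IsLower m k S)
    (hl : l < n) (hlS : ¬ L.Has S l) (hlk : l ≠ k - 1) (hT : S.addEdge (L.e l) = some T)
    (h' : L.IsUpper m' k' T) : m' < m ∨ m' = m ∧ k < k' := by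
  have hmn := h.lt
  have hmn' := h'.lt
  have i := h.index
  have i' := h'.index
  have hh : ∀ {l'}, l' < n → (L.Has T l' ↔ l' = l ∨ L.Has S l') :=
    fun hl' => L.has_addEdge hl hT hl'
  have hlm : l ≤ m := by
    by_contra hlt
    exact hlS (h.has l (by omega) hl)
  have htop : m' ≤ m := by
    by_contra hlt
    exact h'.not_has m' (by omega) le_rfl ((hh hmn').2 (Or.inr (h.has m' (by omega) hmn')))
  rcases htop.lt_or_eq with hlt | rfl
  · exact Or.inl hlt
  refine Or.inr ⟨rfl, ?_⟩
  -- An edge added between `k` and `m` makes the descent stop after it. One added below `k - 1`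
  -- leaves the `k`-th vertex isolated with color `1`, so `T` would still be a lower state.
  by_cases hkl : k ≤ l
  · by_contra hlt
    exact h'.not_has l (by omega) hlm ((hh hl).2 (Or.inl rfl))
  · refine absurd ?_ (h'.not_isLower (m := m') (k := k))
    have hpred : ¬ L.Has T (k - 1) := fun k₁ => by
      rcases (hh (by omega)).1 k₁ with h₁ | h₁
      · omega
      · exact h.not_has_pred h₁
    have hnot : ∀ l', k ≤ l' → l' ≤ m' → ¬ L.Has T l' := fun l' h₁ h₂ k₁ => by
      rcases (hh (by omega)).1 k₁ with h₃ | h₃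
      · omega
      · exact h.not_has l' h₁ h₂ h₃
    refine ⟨⟨hmn, i, fun l' h₁ h₂ => (hh h₂).2 (Or.inr (h.has l' h₁ h₂)), hnot,
      fun l' h₁ h₂ => ((addEdge_some hT).2.color _).2 ⟨_, Conn.refl _ _, h.color l' h₁ h₂⟩⟩,
      hpred, fun hm => ?_⟩
    rw [colorAt_addEdge hT (by omega) (by omega) (hnot k le_rfl (by omega)) hpred]
    exact h.color_one hm

/-- Connectivity after adding an edge at an isolated vertex. -/
theorem IsLower.conn_of_conn {m k : ℕ} {S T : EnhancedState Γ v₀} (h : L.IsLower m k S)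
    (hm : 1 ≤ m) (hT : ∀ f, f ∈ T.edges ↔ f = (L.e (k - 1)).1 ∨ f ∈ S.edges) {u w : V(Γ)}
    (hu : u ≠ L.v k) (hw : w ≠ L.v k) (huw : T.Conn u w) : S.Conn u w := by
  classical
  have hmn := h.lt
  have i := h.index
  have hTe : T.edges = insert (L.e (k - 1)).1 S.edges := by
    ext f
    simp [hT]
  have hlk := L.link (k - 1)
  rw [Nat.sub_add_cancel (by omega)] at hlk
  unfold Conn at huw
  rw [hTe] at huw
  have iso : ∀ {z}, S.Conn z (L.v k) → z = L.v k := fun hz =>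
    L.eq_of_conn (by omega) (by omega) (h.not_has k le_rfl (by omega)) h.not_has_pred hz
  rcases connSetoid_insert hlk huw with h₁ | ⟨-, h₁⟩ | ⟨h₁, -⟩
  · exact h₁
  · exact absurd (iso h₁) hw
  · exact absurd (iso h₁) hu

/-- The state `S` can be recovered from `T`: for `m ≥ 1` the `k`-th vertex has color `1`, and
attaching it changes no other color; for `m = 0` all colors are `x`. -/
theorem IsLower.eq_of_addEdge {m k : ℕ} {S S' T : EnhancedState Γ v₀} (h : L.IsLower m k S)
    (h' : L.IsLower m k S') (hT : S.addEdge (L.e (k - 1)) = some T)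
    (hT' : S'.addEdge (L.e (k - 1)) = some T) : S = S' := by
  have hmn := h.lt
  have i := h.index
  refine ext_of_colorAt (L.edges_eq_of_has fun l hl => ?_) fun w => ?_
  · by_cases hlk : l = k - 1
    · subst hlk
      exact iff_of_false h.not_has_pred h'.not_has_pred
    · have h₁ := L.has_addEdge (by omega) hT hl
      have h₂ := L.has_addEdge (by omega) hT' hl
      tauto
  · rcases Nat.eq_zero_or_pos m with rfl | hm
    · rw [L.colorAt_of_forall h.has, L.colorAt_of_forall h'.has]
    by_cases hw : w = L.v k
    · rw [hw, h.color_one hm, h'.color_one hm]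
    have key : ∀ {S : EnhancedState Γ v₀}, L.IsLower m k S → S.addEdge (L.e (k - 1)) = some T →
        (S.colorAt w = Color.x ↔ T.colorAt w = Color.x) := by
      intro S h hT
      obtain ⟨h₁, h₂⟩ := addEdge_some hT
      rw [h₂.color]
      refine ⟨fun hc => ⟨w, Conn.refl _ _, hc⟩, ?_⟩
      rintro ⟨u, hu, hc⟩
      have huk : u ≠ L.v k := by
        rintro rfl
        rw [h.color_one hm] at hc
        cases hc
      rwa [← S.colorAt_eq_of_conn (h.conn_of_conn hm h₁ huk hw hu)]
    have hx := (key h hT).trans (key h' hT').symm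
    by_cases hc : S.colorAt w = Color.x
    · rw [hc, hx.1 hc]
    · rw [color_eq_one_of_ne hc, color_eq_one_of_ne fun h => hc (hx.2 h)]

/-- Removing the edge `k - 1` isolates the `k`-th vertex if `m ≥ 1`. Giving it color `1` and keeping
the other colors yields the partner. -/
theorem IsUpper.exists_isLower {m k : ℕ} {T : EnhancedState Γ v₀} (h : L.IsUpper m k T) :
    ∃ S, L.IsLower m k S ∧ S.addEdge (L.e (k - 1)) = some T := by
  classical
  have hmn := h.lt
  have i := h.index
  have hsub : ((T.edges.erase (L.e (k - 1)).1 : Finset β) : Set β) ⊆ E(Γ) :=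
    (Finset.coe_subset.2 (Finset.erase_subset _ _)).trans T.edges_subset
  have hhas : ∀ l < n, (L.e l).1 ∈ T.edges.erase (L.e (k - 1)).1 ↔ l ≠ k - 1 ∧ L.Has T l := by
    intro l hl
    rw [Finset.mem_erase]
    refine and_congr_left fun _ => not_congr ⟨fun k₁ => L.e_inj _ hl _ (by omega)
      (Subtype.ext k₁), ?_⟩
    rintro rfl
    rfl
  rcases Nat.eq_zero_or_pos m with rfl | hm
  · obtain rfl : k = 1 := by omega
    -- Without the edge `0` the state is a spanning path through the base vertex, so all colors must
    -- be `x`.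
    set S : EnhancedState Γ v₀ := ofColoring (T.edges.erase (L.e (1 - 1)).1) hsub
      (fun _ => Color.x) (fun _ _ _ _ _ => rfl) rfl with hS
    have hA : L.IsLower 0 1 S :=
      ⟨⟨hmn, i, fun l h₁ h₂ => (hhas l h₂).2 ⟨by omega, h.has l h₁ h₂⟩, fun l _ _ => by omega,
        fun l _ _ => by omega⟩, fun k₁ => ((hhas _ (by omega)).1 k₁).1 rfl, fun _ => by omega⟩
    refine ⟨S, hA, ?_⟩
    obtain ⟨T', hT'⟩ := hA.exists_addEdge
    have hB := hA.isUpper hT'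
    rw [hT']
    refine congrArg some (ext_of_colorAt (L.edges_eq_of_has fun l hl => ?_) fun w => ?_)
    · rcases Nat.eq_zero_or_pos l with rfl | hl0
      · exact iff_of_true hB.has_pred h.has_pred
      · exact iff_of_true (hB.has l hl0 hl) (h.has l hl0 hl)
    · rw [L.colorAt_of_forall hB.has, L.colorAt_of_forall h.has]
  · have hk : 1 ≤ k ∧ k ≤ m := by omega
    have hlk := L.link (k - 1)
    rw [Nat.sub_add_cancel hk.1] at hlk
    have hvk : v₀ ≠ L.v k := by
      intro h₀
      have := L.v_inj 0 (by omega) k (by omega) (L.v_zero.trans h₀)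
      omega
    have hpk : L.v (k - 1) ≠ L.v k := by
      intro h₀
      have := L.v_inj (k - 1) (by omega) k (by omega) h₀
      omega
    have hend : ∀ f ∈ T.edges.erase (L.e (k - 1)).1, ∀ w : V(Γ), ¬ Γ.IsLink f (L.v k) w := by
      intro f hf w hl
      obtain ⟨l, hln, hlf⟩ := L.e_surj ⟨f, hl.edge_mem⟩
      have hlf : (L.e l).1 = f := congrArg Subtype.val hlf
      subst hlf
      have hf := (hhas l hln).1 hf
      rcases L.eq_or_eq_of_isLink hk.1 (by omega) hln hl with ⟨rfl, -⟩ | ⟨rfl, -⟩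
      · exact h.not_has l le_rfl hk.2 hf.2
      · exact hf.1 rfl
    set S : EnhancedState Γ v₀ := ofColoring (T.edges.erase (L.e (k - 1)).1) hsub
      (fun w => if w = L.v k then Color.one else T.colorAt w)
      (by
        intro f hf u w hl
        have hu : u ≠ L.v k := by
          rintro rfl
          exact hend f hf w hl
        have hw : w ≠ L.v k := by
          rintro rfl
          exact hend f hf u hl.symm
        rw [if_neg hu, if_neg hw]
        exact T.colorAt_eq_of_conn (T.conn_of_isLink (Finset.mem_of_mem_erase hf) hl))
      (by rw [if_neg hvk, T.colorAt_base]) with hS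
    have hc₁ : S.colorAt (L.v k) = Color.one := if_pos rfl
    have hc₂ : ∀ {w}, w ≠ L.v k → S.colorAt w = T.colorAt w := fun hw => if_neg hw
    have hA : L.IsLower m k S :=
      ⟨⟨hmn, i, fun l h₁ h₂ => (hhas l h₂).2 ⟨by omega, h.has l h₁ h₂⟩,
        fun l h₁ h₂ k₁ => h.not_has l h₁ h₂ ((hhas l (by omega)).1 k₁).2, fun l h₁ h₂ => by
          rw [hc₂ fun h₀ => by
            have := L.v_inj l (by omega) k (by omega) h₀
            omega]
          exact h.color l h₁ h₂⟩, fun k₁ => ((hhas _ (by omega)).1 k₁).1 rfl, fun _ => hc₁⟩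
    refine ⟨S, hA, ?_⟩
    have hTe : ∀ f, f ∈ T.edges ↔ f = (L.e (k - 1)).1 ∨ f ∈ S.edges := by
      intro f
      change _ ↔ _ ∨ f ∈ T.edges.erase (L.e (k - 1)).1
      rw [Finset.mem_erase]
      by_cases hf : f = (L.e (k - 1)).1
      · rw [hf]
        exact iff_of_true h.has_pred (Or.inl rfl)
      · simp [hf]
    -- Colors are compared through `Extends.unique`: `T` and the result of adding the edge both
    -- extend `S` and have the same edges.
    have hext : S.Extends T := by
      have hne : ∀ {u}, S.colorAt u = Color.x → u ≠ L.v k := by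
        rintro u hu rfl
        rw [hc₁] at hu
        cases hu
      refine ⟨Finset.erase_subset _ _, fun u w hu hw huw =>
        hA.conn_of_conn hm hTe (hne hu) (hne hw) huw, fun w => ⟨fun hw => ?_, ?_⟩⟩
      · by_cases hwk : w = L.v k
        · have hconn := T.conn_of_isLink h.has_pred hlk
          refine ⟨L.v (k - 1), hwk ▸ hconn, ?_⟩
          rw [hc₂ hpk, T.colorAt_eq_of_conn hconn, ← hwk, hw]
        · exact ⟨w, Conn.refl _ _, by rw [hc₂ hwk, hw]⟩
      · rintro ⟨u, hu, hc⟩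
        rw [← T.colorAt_eq_of_conn hu, ← hc₂ (hne hc), hc]
    obtain ⟨T', hT'⟩ := hA.exists_addEdge
    obtain ⟨h₁, h₂⟩ := addEdge_some hT'
    rw [hT', h₂.unique hext]
    ext f
    rw [h₁, hTe]

/-- The rank encodes the lexicographic order, with `m` first and then decreasing `k`, in one natural
number; the factor `n + 1` exceeds every value of `n - k`. The bound on `k'` keeps the truncated
subtraction strictly decreasing. -/
theorem rank_lt {n m k m' k' : ℕ} (hk' : k' ≤ n) (h : m' < m ∨ m' = m ∧ k < k') :
    m' * (n + 1) + (n - k') < m * (n + 1) + (n - k) := by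
  rcases h with h | ⟨rfl, h⟩
  · have := Nat.mul_le_mul_right (n + 1) (Nat.succ_le_of_lt h)
    rw [Nat.succ_mul] at this
    omega
  · omega

theorem IsPattern.index_le_length {m k : ℕ} {S : EnhancedState Γ v₀} (h : L.IsPattern m k S) : k ≤ n := by
  have := h.index
  have := h.lt
  omega

variable (L) in
theorem matching [LinearOrder β] [Finite E(Γ)] : Matching (Γ := Γ) (v₀ := v₀)
    (fun p S => ∃ m k, m * (n + 1) + (n - k) = p ∧ L.IsLower m k S)
    (fun p S => ∃ m k, m * (n + 1) + (n - k) = p ∧ L.IsUpper m k S)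
    (fun S => ∃ m, L.IsCritical m S) where
  cover S := by
    rcases L.isLower_or_isUpper_or_isCritical S with ⟨m, k, h⟩ | ⟨m, k, h⟩ | h
    · exact Or.inl ⟨_, m, k, rfl, h⟩
    · exact Or.inr (Or.inl ⟨_, m, k, rfl, h⟩)
    · exact Or.inr (Or.inr h)
  disjoint_left := by
    rintro p q S ⟨m, k, -, h⟩ ⟨m', k', -, h'⟩
    exact h.not_isLower h'
  disjoint_right := by
    rintro p S ⟨m, k, -, h⟩ ⟨m', h'⟩
    exact h'.not_isUpper h
  disjoint_critical := by
    rintro p S ⟨m, k, -, h⟩ ⟨m', h'⟩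
    exact h'.not_isLower h
  down := by
    rintro p T ⟨m, k, rfl, h⟩
    obtain ⟨S, hS, hT⟩ := h.exists_isLower
    refine ⟨S, L.e (k - 1), ⟨_, m, k, rfl, hS⟩, hS.not_has_pred, hT, ?_⟩
    rintro f hf hfe q T' hT' ⟨m', k', rfl, h'⟩
    obtain ⟨l, hl, rfl⟩ := L.e_surj f
    refine rank_lt h'.index_le_length (hS.lt_of_isUpper hl hf ?_ hT' h')
    rintro rfl
    exact hfe rfl
  up := by
    rintro p S ⟨m, k, rfl, h⟩
    obtain ⟨T, hT⟩ := h.exists_addEdge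
    have hB := h.isUpper hT
    refine ⟨L.e (k - 1), T, _, h.not_has_pred, hT, ⟨m, k, rfl, hB⟩, ?_⟩
    rintro p' S' f ⟨m', k', rfl, h'⟩ hf hT'
    obtain ⟨l, hl, rfl⟩ := L.e_surj f
    by_cases hlk : l = k' - 1
    · subst hlk
      obtain ⟨rfl, rfl⟩ := hB.unique (h'.isUpper hT')
      exact Or.inl ⟨h'.eq_of_addEdge h hT' hT, rfl⟩
    · exact Or.inr (rank_lt hB.index_le_length (h'.lt_of_isUpper hl hf hlk hT' hB))

/-! ### The critical states -/

variable (L) in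
theorem exists_isCritical {m : ℕ} (hm : 1 ≤ m) (hmn : m < n) : ∃ S, L.IsCritical m S := by
  classical
  refine ⟨ofColoring ((Finset.Ioo m n).image fun l => (L.e l).1) ?_ (fun _ => Color.x)
    (fun _ _ _ _ _ => rfl) rfl, hm, hmn, fun l hl => ?_, fun _ => rfl⟩
  · intro f hf
    obtain ⟨l, -, rfl⟩ := Finset.mem_image.1 (Finset.mem_coe.1 hf)
    exact (L.e l).2
  · change (L.e l).1 ∈ (Finset.Ioo m n).image (fun l => (L.e l).1) ↔ _
    rw [Finset.mem_image]
    constructor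
    · rintro ⟨l', hl', h⟩
      rw [Finset.mem_Ioo] at hl'
      rw [← L.e_inj _ hl'.2 _ hl (Subtype.ext h)]
      exact hl'.1
    · exact fun h => ⟨l, Finset.mem_Ioo.2 ⟨h, hl⟩, rfl⟩

theorem IsCritical.dim_eq {m : ℕ} {S : EnhancedState Γ v₀} (h : L.IsCritical m S) :
    S.dim = (n : ℤ) - 1 - m := by
  classical
  have hS : S.edges = (Finset.Ioo m n).image fun l => (L.e l).1 := by
    ext f
    rw [Finset.mem_image]
    constructor
    · intro hf
      obtain ⟨l, hl, hlf⟩ := L.e_surj ⟨f, S.edges_subset hf⟩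
      have hlf : (L.e l).1 = f := congrArg Subtype.val hlf
      subst hlf
      exact ⟨l, Finset.mem_Ioo.2 ⟨(h.has_iff l hl).1 hf, hl⟩, rfl⟩
    · rintro ⟨l, hl, rfl⟩
      rw [Finset.mem_Ioo] at hl
      exact (h.has_iff l hl.2).2 hl.1
  unfold EnhancedState.dim
  rw [hS, Finset.card_image_of_injOn, Nat.card_Ioo]
  · have := h.lt
    omega
  · intro l hl l' hl' hll
    rw [Finset.mem_coe, Finset.mem_Ioo] at hl hl'
    exact L.e_inj _ hl.2 _ hl'.2 (Subtype.ext hll)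

theorem IsCritical.degree_eq {m : ℕ} {S : EnhancedState Γ v₀} (h : L.IsCritical m S) :
    S.degree = m := by
  have hmn := h.lt
  have iso : ∀ l l', l ≤ m → l' ≤ m → 1 ≤ l' → S.Conn (L.v l) (L.v l') → l = l' := by
    intro l l' hl hl' hl1 hc
    refine L.v_inj _ (by omega) _ (by omega) (L.eq_of_conn hl1 (by omega) ?_ ?_ hc)
    · rw [h.has_iff _ (by omega)]
      omega
    · rw [h.has_iff _ (by omega)]
      omega
  -- The components are those of the vertices `0, …, m`: the vertices `1, …, m` are isolated, and
  -- all later ones are connected to the base vertex.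
  have hbij : Function.Bijective fun l : Fin (m + 1) =>
      (⟨Quotient.mk _ (L.v l), h.color (L.v l)⟩ :
        {C : Component Γ S.edges // S.color C = Color.x}) := by
    constructor
    · intro l l' hll
      have hc : S.Conn (L.v l) (L.v l') := Quotient.exact (Subtype.ext_iff.1 hll)
      apply Fin.ext
      rcases Nat.eq_zero_or_pos l'.1 with h0 | h0
      · rcases Nat.eq_zero_or_pos l.1 with h1 | h1
        · rw [h0, h1]
        · exact (iso _ _ (by omega) (by omega) h1 hc.symm).symm
      · exact iso _ _ (by omega) (by omega) h0 hc
    · rintro ⟨C, hC⟩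
      induction C using Quotient.inductionOn with
      | h w =>
        obtain ⟨l, hl, rfl⟩ := L.v_surj w
        rcases Nat.lt_or_ge m l with hml | hml
        · refine ⟨0, Subtype.ext (Quotient.sound ?_)⟩
          have := L.conn_base (S := S) (fun l h₁ h₂ => (h.has_iff l h₂).2 h₁) hml hl.le
          exact (congrArg (S.Conn · (L.v l)) L.v_zero).mpr this.symm
        · exact ⟨⟨l, by omega⟩, rfl⟩
  unfold EnhancedState.degree
  rw [← Nat.card_eq_of_bijective _ hbij, Nat.card_fin]
  push_cast
  ring

end CycleLabeling

end ChromaticCohomology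

/-! ### The reduced cohomology of a cycle -/

theorem mainTheorem8 {α β : Type*} [LinearOrder β] (n : ℕ) (hn : 1 ≤ n)
    (Γ : Graph α β) [Finite E(Γ)] (hΓ : ChromaticCohomology.IsCycleGraph Γ n) (v₀ : V(Γ)) :
    (∀ i j : ℤ, 0 ≤ i → i ≤ (n : ℤ) - 2 → j = (n : ℤ) - i - 1 →
      Nonempty (ChromaticCohomology.ReducedCohomology Γ v₀ i j ≃ₗ[ℝ] ℝ)) ∧
    (∀ i j : ℤ, ¬ (0 ≤ i ∧ i ≤ (n : ℤ) - 2 ∧ j = (n : ℤ) - i - 1) →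
      Subsingleton (ChromaticCohomology.ReducedCohomology Γ v₀ i j)) := by
  obtain ⟨L⟩ := hΓ.nonempty_labeling hn v₀
  refine ⟨fun i j hi hin hj => ?_, fun i j hij => ?_⟩
  -- The degree of a critical state is its parameter `m`, which forces `m = j`. Dimension and degree
  -- of a critical state add up to `n - 1`, so none has degree `j` and dimension `i ± 1`.
  · obtain ⟨T, hT⟩ := L.exists_isCritical (m := j.toNat) (by omega) (by omega)
    have hd := hT.dim_eq
    have hg := hT.degree_eq
    refine L.matching.nonempty_reducedCohomology_equiv (T := T) ⟨by omega, by omega⟩ ⟨_, hT⟩ ?_ ?_ ?_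
    · rintro S - hSj ⟨m, hm⟩
      have hg := hm.degree_eq
      obtain rfl : m = j.toNat := by omega
      exact hm.unique hT
    · rintro S hSi hSj ⟨m, hm⟩
      have := hm.dim_eq
      have := hm.degree_eq
      omega
    · rintro S hSi hSj ⟨m, hm⟩
      have := hm.dim_eq
      have := hm.degree_eq
      omega
  · refine L.matching.subsingleton_reducedCohomology ?_
    rintro S hSi hSj ⟨m, hm⟩
    have := hm.dim_eq
    have := hm.degree_eq
    have := hm.pos
    have := hm.lt
    omega
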